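/- All graphs are finite and simple. For a graph $G$ on $n\ge 2$ vertices let $\lambda_1\ge\lambda_2\ge\dots\ge\lambda_n$ be the eigenvalues (with multiplicity) of its adjacency matrix. For integers $n\ge 2$, $d\ge 0$ and a real number $\lambda$, an $(n,d,\lambda)$-graph is a $d$-regular graph on $n$ vertices with $\max\{|\lambda_2|,|\lambda_n|\}\le\lambda$. A 1-factorization of $G$ is a collection of pairwise edge-disjoint perfect matchings of $G$ whose union contains every edge of $G$. There exists an integer $d_0$ such that the following holds for every integer $d\ge d_0$ with $d\ge 0$, every even integer $n\ge d+1$ and every real number $\lambda\le \frac{d}{12}$: every $(n,d,\lambda)$-graph has a 1-factorization. -/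

import Mathlib

/-- `A(G)`, the real adjacency matrix of `G`, is Hermitian. -/
theorem SimpleGraph.adjMatrix_real_isHermitian {V : Type*} (G : SimpleGraph V)
    [DecidableRel G.Adj] : (G.adjMatrix ℝ).IsHermitian := by
  rw [Matrix.IsHermitian, Matrix.conjTranspose_eq_transpose_of_trivial]
  exact G.isSymm_adjMatrix

/-- The eigenvalues `λ₁ ≥ λ₂ ≥ ⋯ ≥ λₙ` (with multiplicity) of the adjacency matrix of a graph on
`n` vertices; the index is 0-based, so `G.adjEigenvalue i` is `λ_{i+1}`. -/
noncomputable def SimpleGraph.adjEigenvalue {V : Type*} [Fintype V] [DecidableEq V]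
    (G : SimpleGraph V) [DecidableRel G.Adj] (i : Fin (Fintype.card V)) : ℝ :=
  G.adjMatrix_real_isHermitian.eigenvalues₀ i

/-- `λ(G) = max {|λ₂|, |λₙ|}`, for a graph on `n ≥ 2` vertices. -/
noncomputable def SimpleGraph.spectralLambda {V : Type*} [Fintype V] [DecidableEq V]
    (G : SimpleGraph V) [DecidableRel G.Adj] (h : 2 ≤ Fintype.card V) : ℝ :=
  max |G.adjEigenvalue ⟨1, by omega⟩| |G.adjEigenvalue ⟨Fintype.card V - 1, by omega⟩|

/-- `G` is an `(n, d, λ)`-graph: a `d`-regular graph on `n` vertices with `λ(G) ≤ λ`.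
(For `n ≤ 1` there is no `λ₂` and the last condition is void.) -/
def SimpleGraph.IsNDLambdaGraph {V : Type*} [Fintype V] [DecidableEq V]
    (G : SimpleGraph V) [DecidableRel G.Adj] (n d : ℕ) (lam : ℝ) : Prop :=
  Fintype.card V = n ∧ G.IsRegularOfDegree d ∧
    ∀ h : 2 ≤ Fintype.card V, G.spectralLambda h ≤ lam

/-- A 1-factorization of `G`: a collection of perfect matchings of `G`, pairwise edge-disjoint,
whose edge sets together cover the edge set of `G`. -/
structure SimpleGraph.IsOneFactorization {V : Type*} (G : SimpleGraph V)
    (F : Set G.Subgraph) : Prop where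
  isPerfectMatching : ∀ M ∈ F, M.IsPerfectMatching
  edge_disjoint : ∀ M ∈ F, ∀ N ∈ F, M ≠ N → Disjoint M.edgeSet N.edgeSet
  edge_cover : ⋃ M ∈ F, M.edgeSet = G.edgeSet

/-! Colour the vertices by `s₀` in two equal classes that nearly halve every neighbourhood, and let
R be the crossing edges and L the edges inside the classes. If L were empty, G would be regular
bipartite and König's theorem would finish. So L is used up in pieces H, with R as a reservoir: each
H crosses a second colouring `s`, and edges D of R that also cross `s` complete it to a regular
bipartite graph, which is 1-factorable (`Mixing.exists_completion`). The rest, R \ D with L \ H, is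
regular again, and the procedure repeats until L is exhausted.

Completion is a factor problem with prescribed degrees. Its Ore–Ryser condition follows from the
expander mixing lemma, and this is where λ ≤ d/12 enters.

Peeling off matchings one at a time costs about ten reservoir degrees each, too much for an L of
degree d/2. Hence L is first halved up to 14 times. The half of L that crosses a well-distributed
`s` is nearly regular, so completing it costs only a multiple of the irregularity
(`exists_halving_step`). Once L has degree of order d/10⁴, matchings are affordable
(`exists_factorable_of_sparse`).

Since n is not bounded in terms of d, a union bound cannot produce the colourings; the local lemma
does (`exists_halving`). They also separate the pairs of a given fixed-point-free involution, which
makes the classes equal and lets a given matching cross. -/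

/-! ### The Lovász local lemma by counting. -/

section LocalLemma

open Finset
open scoped Classical

/-- Two families of Boolean vectors that are determined by disjoint sets of coordinates are
independent. -/
theorem card_inter_mul_of_determined {ι : Type*} [Fintype ι] {S T : Finset (ι → Bool)}
    {I J : Finset ι} (hIJ : Disjoint I J)
    (hS : ∀ x y : ι → Bool, (∀ i ∈ I, x i = y i) → x ∈ S → y ∈ S)
    (hT : ∀ x y : ι → Bool, (∀ i ∈ J, x i = y i) → x ∈ T → y ∈ T) :
    #(S ∩ T) * #(univ : Finset (ι → Bool)) = #S * #T := by
  rw [← card_product, ← card_product]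
  -- Exchanging the coordinates outside `I` is an involution taking (S ∩ T) × univ onto S × T.
  let φ : (ι → Bool) × (ι → Bool) → (ι → Bool) × (ι → Bool) := fun p =>
    (fun i => if i ∈ I then p.1 i else p.2 i, fun i => if i ∈ I then p.2 i else p.1 i)
  have hφ : ∀ p, φ (φ p) = p := by
    rintro ⟨x, y⟩
    ext i <;> by_cases hi : i ∈ I <;> simp [φ, hi]
  have hJI : ∀ i ∈ J, i ∉ I := fun i hj hi => disjoint_left.1 hIJ hi hj
  refine card_nbij' φ φ ?_ ?_ (fun p _ => hφ p) (fun p _ => hφ p)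
  · rintro ⟨x, y⟩ hp
    simp only [coe_product, Set.mem_prod, mem_coe, mem_inter] at hp ⊢
    refine ⟨hS x _ (fun i hi => ?_) hp.1.1, hT x _ (fun i hi => ?_) hp.1.2⟩
    · simp [φ, hi]
    · simp [φ, hJI i hi]
  · rintro ⟨x, y⟩ hp
    simp only [coe_product, Set.mem_prod, mem_coe, mem_inter] at hp ⊢
    refine ⟨⟨hS x _ (fun i hi => ?_) hp.1, hT y _ (fun i hi => ?_) hp.2⟩, mem_univ _⟩
    · simp [φ, hi]
    · simp [φ, hJI i hi]

/-- The symmetric Lovász local lemma for uniformly random Boolean vectors. -/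
theorem exists_forall_notMem_of_local {ι κ : Type*} [Fintype ι] [Fintype κ]
    (E : κ → Finset (ι → Bool)) (vbl : κ → Finset ι)
    (hdet : ∀ k, ∀ x y : ι → Bool, (∀ i ∈ vbl k, x i = y i) → x ∈ E k → y ∈ E k)
    {p D : ℝ} (hp : 0 ≤ p) (hD : 1 ≤ D) (hpD : 4 * p * D ≤ 1)
    (hE : ∀ k, (#(E k) : ℝ) ≤ p * #(univ : Finset (ι → Bool)))
    (hdeg : ∀ k, (#{j | ¬ Disjoint (vbl j) (vbl k)} : ℝ) ≤ D) :
    ∃ x, ∀ k, x ∉ E k := by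
  set N : ℝ := ((#(univ : Finset (ι → Bool)) : ℕ) : ℝ) with hN
  have hN0 : 0 < N := by
    rw [hN]; exact_mod_cast card_pos.2 univ_nonempty
  let B : Finset κ → Finset (ι → Bool) := fun S => {x | ∀ j ∈ S, x ∉ E j}
  have hBmono : ∀ {S T : Finset κ}, S ⊆ T → B T ⊆ B S := by
    intro S T h x hx
    simp only [B, mem_filter, mem_univ, true_and] at hx ⊢
    exact fun j hj => hx j (h hj)
  -- Given that all events of `S` fail, `E k` has conditional probability at most 2p. The events of
  -- `S` independent of `E k` give the bound p, and imposing the at most D others keeps at least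
  -- half of the vectors, as 2pD ≤ 1/2.
  have key : ∀ m : ℕ, ∀ S : Finset κ, #S = m → ∀ k,
      (#(E k ∩ B S) : ℝ) ≤ 2 * p * #(B S) := by
    intro m
    induction m using Nat.strong_induction_on with
    | _ m ih =>
    intro S hSm k
    set S₁ := S.filter (fun j => ¬ Disjoint (vbl j) (vbl k)) with hS₁
    set S₂ := S.filter (fun j => Disjoint (vbl j) (vbl k)) with hS₂
    have hindep : (#(E k ∩ B S₂) : ℝ) ≤ p * #(B S₂) := by
      have h := card_inter_mul_of_determined (S := E k) (T := B S₂) (I := vbl k)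
        (J := S₂.biUnion vbl) (by
          rw [disjoint_biUnion_right]
          intro j hj
          exact (mem_filter.1 hj).2.symm) (hdet k) (by
          intro x y hxy hx
          simp only [B, mem_filter, mem_univ, true_and] at hx ⊢
          intro j hj hy
          exact hx j hj (hdet j y x (fun i hi => (hxy i (mem_biUnion.2 ⟨j, hj, hi⟩)).symm) hy))
      have h' : (#(E k ∩ B S₂) : ℝ) * N = #(E k) * #(B S₂) := by rw [hN]; exact_mod_cast h
      have h2 : (#(E k) : ℝ) * #(B S₂) ≤ p * N * #(B S₂) :=
        mul_le_mul_of_nonneg_right (hE k) (Nat.cast_nonneg _)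
      nlinarith
    have hsub : (#(E k ∩ B S) : ℝ) ≤ #(E k ∩ B S₂) := by
      exact_mod_cast card_le_card (inter_subset_inter_left (hBmono (filter_subset _ _)))
    have hhalf : (#(B S₂) : ℝ) ≤ 2 * #(B S) := by
      by_cases he : S₁ = ∅
      · have : S₂ = S := by
          rw [hS₂, filter_eq_self]
          intro j hj
          by_contra hc
          exact notMem_empty j (he ▸ mem_filter.2 ⟨hj, hc⟩)
        rw [this]
        have : (0 : ℝ) ≤ #(B S) := Nat.cast_nonneg _
        linarith
      · have hlt : #S₂ < m := by
          have h1 := card_filter_add_card_filter_not (s := S)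
            (fun j => Disjoint (vbl j) (vbl k))
          have h2 : 0 < #S₁ := card_pos.2 (nonempty_iff_ne_empty.2 he)
          simp only [← hS₁, ← hS₂] at h1
          omega
        have hcov : B S₂ ⊆ B S ∪ S₁.biUnion (fun j => E j ∩ B S₂) := by
          intro x hx
          by_cases hxS : x ∈ B S
          · exact mem_union_left _ hxS
          · refine mem_union_right _ (mem_biUnion.2 ?_)
            simp only [B, mem_filter, mem_univ, true_and, not_forall, not_not] at hxS
            obtain ⟨j, hj, hxj⟩ := hxS
            refine ⟨j, mem_filter.2 ⟨hj, fun hd => ?_⟩, mem_inter.2 ⟨hxj, hx⟩⟩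
            simp only [B, mem_filter, mem_univ, true_and] at hx
            exact hx j (mem_filter.2 ⟨hj, hd⟩) hxj
        have h1 : (#(B S₂) : ℝ) ≤ #(B S) + ∑ j ∈ S₁, (#(E j ∩ B S₂) : ℝ) := by
          have := (card_le_card hcov).trans (card_union_le _ _)
          have h3 := this.trans (Nat.add_le_add_left card_biUnion_le _)
          exact_mod_cast h3
        have h2 : ∑ j ∈ S₁, (#(E j ∩ B S₂) : ℝ) ≤ #S₁ * (2 * p * #(B S₂)) := by
          rw [← nsmul_eq_mul]
          exact sum_le_card_nsmul _ _ _ (fun j _ => ih _ hlt S₂ rfl j)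
        have h3 : (#S₁ : ℝ) ≤ D := by
          refine le_trans ?_ (hdeg k)
          exact_mod_cast card_le_card (filter_subset_filter _ (subset_univ S))
        have h4 : (0 : ℝ) ≤ #(B S₂) := Nat.cast_nonneg _
        have h5 : (#S₁ : ℝ) * (2 * p * #(B S₂)) ≤ D * (2 * p * #(B S₂)) :=
          mul_le_mul_of_nonneg_right h3 (by positivity)
        nlinarith
    nlinarith
  have hpos : ∀ S : Finset κ, 0 < (#(B S) : ℝ) := by
    intro S
    induction S using Finset.induction_on with
    | empty => simp [B]
    | insert k S hk ih =>
      have h1 : B S ⊆ B (insert k S) ∪ (E k ∩ B S) := by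
        intro x hx
        by_cases hxk : x ∈ E k
        · exact mem_union_right _ (mem_inter.2 ⟨hxk, hx⟩)
        · refine mem_union_left _ ?_
          simp only [B, mem_filter, mem_univ, true_and] at hx ⊢
          intro j hj
          rcases mem_insert.1 hj with rfl | hj
          · exact hxk
          · exact hx j hj
      have h2 : (#(B S) : ℝ) ≤ #(B (insert k S)) + #(E k ∩ B S) := by
        exact_mod_cast (card_le_card h1).trans (card_union_le _ _)
      have h3 := key _ S rfl k
      have h4 : 2 * p ≤ 1 / 2 := by nlinarith
      nlinarith
  obtain ⟨x, hx⟩ := card_pos.1 (show 0 < #(B univ) by exact_mod_cast hpos univ)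
  exact ⟨x, fun k => (mem_filter.1 hx).2 k (mem_univ k)⟩

end LocalLemma

/-! ### Concentration and low-discrepancy colourings. -/

section Halving

open Finset
open scoped Classical

/-- The sign `±1` of a Boolean. -/
def Bool.sgn (b : Bool) : ℝ := if b then 1 else -1

theorem Bool.sgn_xor (a b : Bool) : (xor a b).sgn = -(a.sgn * b.sgn) := by
  cases a <;> cases b <;> simp [Bool.sgn]

theorem Bool.abs_sgn (a : Bool) : |a.sgn| = 1 := by
  cases a <;> simp [Bool.sgn]

/-- Hoeffding's inequality for weighted sums of independent signs. -/
theorem card_le_sum_sgn_le {ι : Type*} [Fintype ι] (c : ι → ℝ) {a C : ℝ} (ha : 0 ≤ a) (hC : 0 < C)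
    (hc : ∑ i, c i ^ 2 ≤ C) :
    (#{x : ι → Bool | a ≤ ∑ i, c i * (x i).sgn} : ℝ) ≤
      Real.exp (-(a ^ 2 / (2 * C))) * #(univ : Finset (ι → Bool)) := by
  -- This value minimizes the Chernoff exponent t²C/2 - ta.
  set t := a / C with ht
  have ht0 : 0 ≤ t := by positivity
  have h1 : ∑ x : ι → Bool, Real.exp (t * ∑ i, c i * (x i).sgn) =
      ∏ i, (2 * Real.cosh (t * c i)) := by
    have : ∀ x : ι → Bool, Real.exp (t * ∑ i, c i * (x i).sgn) =
        ∏ i, Real.exp (t * (c i * (x i).sgn)) := by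
      intro x
      rw [mul_sum, Real.exp_sum]
    simp_rw [this]
    rw [← Fintype.piFinset_univ, ← Finset.prod_univ_sum (fun _ => univ)
      (fun i (b : Bool) => Real.exp (t * (c i * b.sgn)))]
    refine prod_congr rfl fun i _ => ?_
    rw [Fintype.sum_bool, Real.cosh_eq]
    simp [Bool.sgn]
    ring
  have h2 : ∏ i, (2 * Real.cosh (t * c i)) ≤
      #(univ : Finset (ι → Bool)) * Real.exp (t ^ 2 * C / 2) := by
    calc ∏ i, (2 * Real.cosh (t * c i)) ≤ ∏ i, (2 * Real.exp ((t * c i) ^ 2 / 2)) := by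
          refine prod_le_prod (fun i _ => ?_) (fun i _ => ?_)
          · have := Real.cosh_pos (t * c i)
            positivity
          · have := Real.cosh_le_exp_half_sq (t * c i)
            linarith
      _ = #(univ : Finset (ι → Bool)) * Real.exp (t ^ 2 * (∑ i, c i ^ 2) / 2) := by
          rw [prod_mul_distrib, ← Real.exp_sum]
          congr 1
          · simp
          · congr 1
            rw [mul_sum, sum_div]
            exact sum_congr rfl fun i _ => by ring
      _ ≤ _ := by gcongr
  have h3 : (#{x : ι → Bool | a ≤ ∑ i, c i * (x i).sgn} : ℝ) * Real.exp (t * a) ≤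
      ∑ x : ι → Bool, Real.exp (t * ∑ i, c i * (x i).sgn) := by
    rw [← nsmul_eq_mul]
    refine (card_nsmul_le_sum _ _ _ (fun x hx => ?_)).trans
      (sum_le_sum_of_subset_of_nonneg (filter_subset _ univ) fun _ _ _ => (Real.exp_pos _).le)
    exact Real.exp_le_exp.2 (mul_le_mul_of_nonneg_left (mem_filter.1 hx).2 ht0)
  have h4 := (h3.trans h1.le).trans h2
  rw [← le_div_iff₀ (Real.exp_pos _), mul_div_assoc, ← Real.exp_sub] at h4
  refine h4.trans (le_of_eq ?_)
  rw [mul_comm]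
  congr 2
  rw [ht]
  field_simp
  ring

theorem card_le_abs_sum_sgn_le {ι : Type*} [Fintype ι] (c : ι → ℝ) {a C : ℝ} (ha : 0 ≤ a)
    (hC : 0 < C) (hc : ∑ i, c i ^ 2 ≤ C) :
    (#{x : ι → Bool | a ≤ |∑ i, c i * (x i).sgn|} : ℝ) ≤
      2 * Real.exp (-(a ^ 2 / (2 * C))) * #(univ : Finset (ι → Bool)) := by
  have h1 := card_le_sum_sgn_le c ha hC hc
  have h2 := card_le_sum_sgn_le (fun i => -c i) ha hC (by simpa using hc)
  have h3 : ({x : ι → Bool | a ≤ |∑ i, c i * (x i).sgn|} : Finset (ι → Bool)) ⊆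
      ({x : ι → Bool | a ≤ ∑ i, c i * (x i).sgn} : Finset (ι → Bool)) ∪
      ({x : ι → Bool | a ≤ ∑ i, -c i * (x i).sgn} : Finset (ι → Bool)) := by
    intro x hx
    simp only [mem_filter, mem_univ, true_and, mem_union, neg_mul, sum_neg_distrib] at hx ⊢
    exact le_abs.1 hx
  have h4 : (#{x : ι → Bool | a ≤ |∑ i, c i * (x i).sgn|} : ℝ) ≤
      #{x : ι → Bool | a ≤ ∑ i, c i * (x i).sgn} +
      #{x : ι → Bool | a ≤ ∑ i, -c i * (x i).sgn} := by
    exact_mod_cast (card_le_card h3).trans (card_union_le _ _)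
  linarith

/-- A hypergraph whose edges and degrees are at most of order `d` has, for any pairing `σ` of its
vertices, a 2-colouring separating all pairs and with discrepancy at most `ε d`. -/
theorem exists_halving (ε : ℝ) (hε : 0 < ε) : ∃ d₀ : ℕ, ∀ d : ℕ, d₀ ≤ d →
    ∀ {V κ : Type} [Fintype V] [Fintype κ] (σ : V → V) (S : κ → Finset V),
      (∀ v, σ (σ v) = v) → (∀ v, σ v ≠ v) → (∀ k, #(S k) ≤ d) →
      (∀ v, #{k | v ∈ S k} ≤ 4 * d) →
      ∃ s : V → Bool, (∀ v, s (σ v) = !(s v)) ∧ ∀ k, |∑ u ∈ S k, (s u).sgn| ≤ ε * d := by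
  -- This is 4pD for p = 2 exp(-ε²d/4) and D = 8d², the values given to the local lemma.
  have hlim : Filter.Tendsto (fun d : ℕ => (64 * (d : ℝ) ^ 2) *
      Real.exp (-(ε ^ 2 / 4) * d)) Filter.atTop (nhds 0) := by
    have h := (Real.tendsto_pow_mul_exp_neg_atTop_nhds_zero 2).comp
      ((Filter.tendsto_id.const_mul_atTop (show 0 < ε ^ 2 / 4 by positivity)).comp
        (tendsto_natCast_atTop_atTop (R := ℝ)))
    have h' := h.const_mul (64 / (ε ^ 2 / 4) ^ 2)
    rw [mul_zero] at h'
    refine h'.congr fun d => ?_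
    simp only [Function.comp, id]
    rw [← neg_mul]
    field_simp
  obtain ⟨d₀, hd₀⟩ := Filter.eventually_atTop.1 (hlim.eventually_le_const zero_lt_one)
  refine ⟨max d₀ 1, fun d hd V κ _ _ σ S hσ hσ' hS hdeg => ?_⟩
  have hd1 : 1 ≤ d := (le_max_right _ _).trans hd
  have hd1' : (1 : ℝ) ≤ d := by exact_mod_cast hd1
  have hd0 := hd₀ d ((le_max_left _ _).trans hd)
  let e := Fintype.equivFin V
  -- One random bit per pair, stored at its representative `r v`; the colour of `v` is this bit,
  -- flipped if `v` is the representative.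
  let r : V → V := fun v => if e v < e (σ v) then v else σ v
  let b : V → Bool := fun v => decide (v = r v)
  have hne : ∀ v, e (σ v) ≠ e v := fun v h => hσ' v (e.injective h)
  have hrσ : ∀ v, r (σ v) = r v := fun v => by
    simp only [r, hσ]
    rcases lt_or_gt_of_ne (hne v) with h | h
    · rw [if_pos h, if_neg h.not_gt]
    · rw [if_neg h.not_gt, if_pos h]
  have hbσ : ∀ v, b (σ v) = !(b v) := by
    intro v
    simp only [b, hrσ]
    rcases lt_or_gt_of_ne (hne v) with h | h
    · have : r v = σ v := if_neg h.not_gt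
      simp [this, (hσ' v).symm]
    · have : r v = v := if_pos h
      simp [this, hσ' v]
  have hfib : ∀ u i, r u = i → u = i ∨ u = σ i := by
    intro u i h
    by_cases h' : e u < e (σ u)
    · left; rw [← h]; exact (if_pos h').symm
    · right; rw [← h]; simp only [r]; rw [if_neg h', hσ]
  let c : κ → V → ℝ := fun k i => ∑ u ∈ S k with r u = i, -(b u).sgn
  have hsum : ∀ k (x : V → Bool), ∑ u ∈ S k, (xor (x (r u)) (b u)).sgn =
      ∑ i, c k i * (x i).sgn := by
    intro k x
    rw [← sum_fiberwise (S k) r]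
    refine sum_congr rfl fun i _ => ?_
    simp only [c]
    rw [sum_mul]
    refine sum_congr rfl fun u hu => ?_
    rw [(mem_filter.1 hu).2, Bool.sgn_xor]
    ring
  have hcabs : ∀ k i, |c k i| ≤ #{u ∈ S k | r u = i} := by
    intro k i
    refine (abs_sum_le_sum_abs _ _).trans ?_
    simp [Bool.abs_sgn]
  have hc2 : ∀ k i, (#{u ∈ S k | r u = i} : ℝ) ≤ 2 := by
    intro k i
    have h1 : ({u ∈ S k | r u = i} : Finset V) ⊆ {i, σ i} := by
      intro u hu
      rcases hfib u i (mem_filter.1 hu).2 with h | h <;> simp [h]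
    exact_mod_cast (card_le_card h1).trans card_le_two
  have hcsq : ∀ k, ∑ i, c k i ^ 2 ≤ 2 * d := by
    intro k
    have h1 : ∀ i, c k i ^ 2 ≤ 2 * #{u ∈ S k | r u = i} := by
      intro i
      rw [← sq_abs]
      nlinarith [hcabs k i, hc2 k i, abs_nonneg (c k i)]
    refine (sum_le_sum fun i _ => h1 i).trans ?_
    rw [← mul_sum]
    have h2 : ∑ i, (#{u ∈ S k | r u = i} : ℝ) = #(S k) := by
      exact_mod_cast (card_eq_sum_card_fiberwise (f := r) (s := S k) (t := univ)
        (fun _ _ => mem_univ _)).symm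
    rw [h2]
    have : (#(S k) : ℝ) ≤ d := by exact_mod_cast hS k
    linarith
  obtain ⟨x, hx⟩ := exists_forall_notMem_of_local
    (fun k => ({x : V → Bool | ε * d ≤ |∑ i, c k i * (x i).sgn|} : Finset (V → Bool)))
    (fun k => (S k).image r) (by
      intro k x y hxy hx
      simp only [mem_filter, mem_univ, true_and] at hx ⊢
      rw [← hsum] at hx ⊢
      have : ∑ u ∈ S k, (xor (y (r u)) (b u)).sgn = ∑ u ∈ S k, (xor (x (r u)) (b u)).sgn :=
        sum_congr rfl fun u hu => by rw [hxy (r u) (mem_image_of_mem r hu)]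
      rw [this]
      exact hx)
    (p := 2 * Real.exp (-(ε ^ 2 / 4) * d)) (D := 8 * (d : ℝ) ^ 2) (by positivity)
    (by nlinarith) (by linarith) (by
      intro k
      have h1 := card_le_abs_sum_sgn_le (c k) (a := ε * d) (C := 2 * d) (by positivity)
        (by positivity) (hcsq k)
      have h2 : (ε * d) ^ 2 / (2 * (2 * d)) = ε ^ 2 / 4 * d := by
        field_simp
        ring
      rw [h2, ← neg_mul] at h1
      exact h1) (by
      intro k
      -- A set depending on a common pair contains some u ∈ `S k` or its partner: d choices of u,
      -- and at most 4d sets through each of the two vertices.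
      have h1 : ({j | ¬ Disjoint ((S j).image r) ((S k).image r)} : Finset κ) ⊆
          (S k).biUnion fun u => ({j | u ∈ S j} : Finset κ) ∪ ({j | σ u ∈ S j} : Finset κ) := by
        intro j hj
        rw [mem_filter, not_disjoint_iff] at hj
        obtain ⟨-, i, hi, hi'⟩ := hj
        obtain ⟨w, hw, rfl⟩ := mem_image.1 hi
        obtain ⟨u, hu, huw⟩ := mem_image.1 hi'
        refine mem_biUnion.2 ⟨u, hu, ?_⟩
        have : w = u ∨ w = σ u := by
          rcases hfib w _ rfl with h | h <;> rcases hfib u _ rfl with h' | h'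
          · left; rw [h, h', huw]
          · right; rw [h, h', huw, hσ]
          · right; rw [h, h', huw]
          · left; rw [h, h', huw]
        rcases this with rfl | rfl <;> simp [hw]
      have h2 := (card_le_card h1).trans (card_biUnion_le_card_mul (S k) _ (8 * d) (fun u _ =>
        (card_union_le _ _).trans (by have := hdeg u; have := hdeg (σ u); omega)))
      have h3 : #(S k) * (8 * d) ≤ d * (8 * d) := Nat.mul_le_mul_right _ (hS k)
      have h4 := h2.trans h3
      have h5 : (#{j | ¬ Disjoint ((S j).image r) ((S k).image r)} : ℝ) ≤ d * (8 * d) := by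
        exact_mod_cast h4
      refine h5.trans (le_of_eq (by ring)))
  refine ⟨fun v => xor (x (r v)) (b v), fun v => ?_, fun k => ?_⟩
  · simp only [hrσ, hbσ]
    cases x (r v) <;> cases b v <;> rfl
  · have := hx k
    simp only [mem_filter, mem_univ, true_and, not_le] at this
    rw [hsum]
    exact this.le

end Halving

/-! ### Bipartite factors with prescribed degrees, and König's theorem. -/

section Factors

open Finset
open scoped Classical

/-- Prescribed row and column sums: a bipartite relation `T` has a subrelation with row sums `f` and
column sums `g` under the Ore–Ryser condition. -/
theorem exists_subset_card_row_col {α β : Type*} [Fintype α] [Fintype β] (T : Finset (α × β))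
    (f : α → ℕ) (g : β → ℕ) (hfg : ∑ a, f a = ∑ b, g b)
    (hT : ∀ (W : Finset α) (Y : Finset β),
      ∑ a ∈ W, f a + ∑ b ∈ Y, g b ≤ ∑ a, f a + #{e ∈ T | e.1 ∈ W ∧ e.2 ∈ Y}) :
    ∃ D ⊆ T, (∀ a, #{e ∈ D | e.1 = a} = f a) ∧ ∀ b, #{e ∈ D | e.2 = b} = g b := by
  let deg : β → ℕ := fun b => #{e ∈ T | e.2 = b}
  have hdeg : ∀ Y : Finset β, ∑ b ∈ Y, deg b = #{e ∈ T | e.2 ∈ Y} := by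
    intro Y
    rw [card_eq_sum_card_fiberwise (f := Prod.snd) (s := {e ∈ T | e.2 ∈ Y}) (t := Y)
      (fun e he => (mem_filter.1 he).2)]
    refine sum_congr rfl fun b hb => ?_
    simp only [deg]
    congr 1
    ext e
    simp only [mem_filter]
    constructor
    · rintro ⟨h1, rfl⟩
      exact ⟨⟨h1, hb⟩, rfl⟩
    · rintro ⟨⟨h1, -⟩, h2⟩
      exact ⟨h1, h2⟩
  have hgdeg : ∀ b, g b ≤ deg b := by
    intro b
    have := hT univ {b}
    simp only [sum_singleton, mem_univ, true_and, mem_singleton] at this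
    simp only [deg]
    omega
  -- Hall's theorem sends each cell to one of the `f a` slots of its row or one of the `deg b - g b`
  -- slots of its column. Slots and cells are equally many, so all slots are filled; the cells sent
  -- to rows form `D`, and exactly `g b` of column `b` are left in it.
  let t : T → Finset ((Σ a, Fin (f a)) ⊕ (Σ b, Fin (deg b - g b))) := fun e =>
    univ.filter (Sum.elim (fun x => x.1 = e.1.1) (fun y => y.1 = e.1.2))
  have hall : ∀ S : Finset T, #S ≤ #(S.biUnion t) := by
    intro S
    let W := S.image (fun e => e.1.1)
    let Y := S.image (fun e => e.1.2)
    have h1 : S.biUnion t = (W.sigma fun _ => univ).disjSum (Y.sigma fun _ => univ) := by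
      ext x
      rcases x with x | x
      · simp [t, W, eq_comm]
      · simp [t, Y, eq_comm]
    have h2 : #(S.biUnion t) = ∑ a ∈ W, f a + ∑ b ∈ Y, (deg b - g b) := by
      rw [h1, card_disjSum, card_sigma, card_sigma]
      simp
    have h3 : #S ≤ #{e ∈ T | e.1 ∈ W ∧ e.2 ∈ Y} := by
      rw [← card_map (Function.Embedding.subtype _)]
      refine card_le_card fun e he => ?_
      obtain ⟨e', he', rfl⟩ := mem_map.1 he
      exact mem_filter.2 ⟨e'.2, mem_image_of_mem _ he', mem_image_of_mem _ he'⟩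
    -- Hall's condition for rows `W` is the Ore–Ryser condition for the complementary rows.
    have h4 := hT Wᶜ Y
    have h5 : #{e ∈ T | e.1 ∈ W ∧ e.2 ∈ Y} + #{e ∈ T | e.1 ∈ Wᶜ ∧ e.2 ∈ Y} =
        ∑ b ∈ Y, deg b := by
      rw [hdeg, ← card_filter_add_card_filter_not (s := {e ∈ T | e.2 ∈ Y}) (fun e => e.1 ∈ W),
        filter_filter, filter_filter]
      simp [and_comm]
    have h6 : ∑ b ∈ Y, (deg b - g b) + ∑ b ∈ Y, g b = ∑ b ∈ Y, deg b := by
      rw [← sum_add_distrib]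
      exact sum_congr rfl fun b _ => Nat.sub_add_cancel (hgdeg b)
    have h7 := sum_add_sum_compl W f
    omega
  obtain ⟨φ, hφ, hφt⟩ := (all_card_le_biUnion_card_iff_exists_injective t).1 hall
  have hcard : Fintype.card T =
      Fintype.card ((Σ a, Fin (f a)) ⊕ (Σ b, Fin (deg b - g b))) := by
    simp only [Fintype.card_sum, Fintype.card_sigma, Fintype.card_fin, Fintype.card_coe]
    have h6 : ∑ b, (deg b - g b) + ∑ b, g b = ∑ b, deg b := by
      rw [← sum_add_distrib]
      exact sum_congr rfl fun b _ => Nat.sub_add_cancel (hgdeg b)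
    have h7 := hdeg univ
    simp only [mem_univ, filter_true] at h7
    omega
  have hbij : Function.Bijective φ := (Fintype.bijective_iff_injective_and_card φ).2 ⟨hφ, hcard⟩
  let ψ := Equiv.ofBijective φ hbij
  have hψ : ∀ x, φ (ψ.symm x) = x := fun x => ψ.apply_symm_apply x
  have hl : ∀ (e : T) a i, φ e = Sum.inl ⟨a, i⟩ → e.1.1 = a := by
    intro e a i h
    have := hφt e
    rw [h] at this
    simpa [t, eq_comm] using this
  have hr : ∀ (e : T) b i, φ e = Sum.inr ⟨b, i⟩ → e.1.2 = b := by
    intro e a i h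
    have := hφt e
    rw [h] at this
    simpa [t, eq_comm] using this
  let D : Finset (α × β) := ((univ : Finset T).filter fun e => (φ e).isLeft).map
    (Function.Embedding.subtype _)
  have hDT : D ⊆ T := by
    intro e he
    obtain ⟨e', -, rfl⟩ := mem_map.1 he
    exact e'.2
  have hrow : ∀ a, #{e ∈ D | e.1 = a} = f a := by
    intro a
    have : ({e ∈ D | e.1 = a} : Finset _) =
        (univ : Finset (Fin (f a))).image (fun i => (ψ.symm (Sum.inl ⟨a, i⟩)).1) := by
      ext e
      simp only [D, mem_filter, mem_map, mem_univ, true_and, mem_image,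
        Function.Embedding.subtype_apply]
      constructor
      · rintro ⟨⟨e', he', rfl⟩, rfl⟩
        obtain ⟨⟨a, i⟩, hx⟩ := Sum.isLeft_iff.1 he'
        obtain rfl := hl _ _ _ hx
        refine ⟨i, ?_⟩
        rw [← hx]
        exact congrArg Subtype.val (ψ.symm_apply_apply e')
      · rintro ⟨i, rfl⟩
        exact ⟨⟨_, by rw [hψ]; rfl, rfl⟩, hl _ _ _ (hψ _)⟩
    rw [this, card_image_of_injective, card_univ, Fintype.card_fin]
    intro i j hij
    have := ψ.symm.injective (Subtype.ext hij)
    simpa using this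
  have hcol : ∀ b, #{e ∈ D | e.2 = b} = g b := by
    intro b
    have h1 : ({e ∈ T | e.2 = b} : Finset _) = {e ∈ D | e.2 = b} ∪
        (univ : Finset (Fin (deg b - g b))).image (fun i => (ψ.symm (Sum.inr ⟨b, i⟩)).1) := by
      ext e
      simp only [D, mem_filter, mem_map, mem_univ, true_and, mem_image, mem_union,
        Function.Embedding.subtype_apply]
      constructor
      · rintro ⟨he, rfl⟩
        rcases hx : φ ⟨e, he⟩ with x | ⟨b, i⟩
        · exact Or.inl ⟨⟨⟨e, he⟩, by rw [hx]; rfl, rfl⟩, rfl⟩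
        · right
          obtain rfl := hr _ _ _ hx
          refine ⟨i, ?_⟩
          rw [← hx]
          exact congrArg Subtype.val (ψ.symm_apply_apply _)
      · rintro (⟨⟨e', he', rfl⟩, rfl⟩ | ⟨i, rfl⟩)
        · exact ⟨e'.2, rfl⟩
        · exact ⟨Subtype.property _, hr _ _ _ (hψ _)⟩
    have h2 : Disjoint ({e ∈ D | e.2 = b} : Finset _)
        ((univ : Finset (Fin (deg b - g b))).image (fun i => (ψ.symm (Sum.inr ⟨b, i⟩)).1)) := by
      rw [disjoint_left]
      intro e he he'
      obtain ⟨i, -, rfl⟩ := mem_image.1 he'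
      obtain ⟨e', he'', h⟩ := mem_map.1 (mem_filter.1 he).1
      have := (mem_filter.1 he'').2
      obtain rfl : e' = _ := Subtype.ext h
      rw [hψ] at this
      simp at this
    have h3 : #((univ : Finset (Fin (deg b - g b))).image
        (fun i => (ψ.symm (Sum.inr ⟨b, i⟩)).1)) = deg b - g b := by
      rw [card_image_of_injective, card_univ, Fintype.card_fin]
      intro i j hij
      have := ψ.symm.injective (Subtype.ext hij)
      simpa using this
    have h4 : deg b = #{e ∈ D | e.2 = b} + (deg b - g b) := by
      rw [← h3, ← card_union_of_disjoint h2, ← h1]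
    have := hgdeg b
    omega
  exact ⟨D, hDT, hrow, hcol⟩

namespace SimpleGraph

variable {V : Type*}

/-- Every edge of `H` joins two vertices on different sides of `s`. -/
def Crosses (H : SimpleGraph V) (s : V → Bool) : Prop := ∀ ⦃u v⦄, H.Adj u v → s u ≠ s v

theorem Crosses.mono {H K : SimpleGraph V} {s : V → Bool} (hK : K.Crosses s) (h : H ≤ K) :
    H.Crosses s := fun _ _ huv => hK (h huv)

/-- The edge set splits into perfect matchings, given as pairwise disjoint 1-regular graphs. -/
def Factorable (H : SimpleGraph V) : Prop :=
  ∃ S : Set (SimpleGraph V), (∀ M ∈ S, ∀ v, ∃! w, M.Adj v w) ∧ S.PairwiseDisjoint id ∧ sSup S = H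

theorem factorable_bot : (⊥ : SimpleGraph V).Factorable :=
  ⟨∅, by simp, by simp, by simp⟩

theorem Factorable.sup {H K : SimpleGraph V} (hH : H.Factorable) (hK : K.Factorable)
    (h : Disjoint H K) : (H ⊔ K).Factorable := by
  obtain ⟨S, hS1, hS2, rfl⟩ := hH
  obtain ⟨T, hT1, hT2, rfl⟩ := hK
  refine ⟨S ∪ T, ?_, ?_, sSup_union⟩
  · rintro M (hM | hM)
    · exact hS1 M hM
    · exact hT1 M hM
  · rintro M (hM | hM) N (hN | hN) hne
    · exact hS2 hM hN hne
    · exact h.mono (le_sSup hM) (le_sSup hN)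
    · exact (h.mono (le_sSup hN) (le_sSup hM)).symm
    · exact hT2 hM hN hne

variable [Fintype V]

/-- The neighbourhood of a vertex as a finite set. -/
noncomputable def nbhd (H : SimpleGraph V) (v : V) : Finset V := {w | H.Adj v w}

/-- The degree of a vertex. -/
noncomputable def valency (H : SimpleGraph V) (v : V) : ℕ := #(H.nbhd v)

@[simp] theorem mem_nbhd {H : SimpleGraph V} {v w : V} : w ∈ H.nbhd v ↔ H.Adj v w := by
  simp [nbhd]

theorem nbhd_mono {H K : SimpleGraph V} (h : H ≤ K) (v : V) : H.nbhd v ⊆ K.nbhd v := by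
  intro w hw
  rw [mem_nbhd] at hw ⊢
  exact h hw

theorem valency_mono {H K : SimpleGraph V} (h : H ≤ K) (v : V) : H.valency v ≤ K.valency v :=
  card_le_card (nbhd_mono h v)

@[simp] theorem valency_bot (v : V) : (⊥ : SimpleGraph V).valency v = 0 := by
  simp [valency, nbhd]

theorem valency_sup_of_disjoint {H K : SimpleGraph V} (h : Disjoint H K) (v : V) :
    (H ⊔ K).valency v = H.valency v + K.valency v := by
  rw [valency, valency, valency, ← card_union_of_disjoint]
  · congr 1
    ext w
    simp
  · rw [Finset.disjoint_left]
    intro w hw hw'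
    rw [mem_nbhd] at hw hw'
    exact (disjoint_left.1 h v w hw) hw'

theorem valency_sdiff {H K : SimpleGraph V} (h : K ≤ H) (v : V) :
    K.valency v + (H \ K).valency v = H.valency v := by
  rw [← valency_sup_of_disjoint disjoint_sdiff_self_right, sup_sdiff_cancel_right h]

theorem eq_bot_of_valency_eq_zero {H : SimpleGraph V} (h : ∀ v, H.valency v = 0) : H = ⊥ := by
  ext v w
  have := h v
  rw [valency, card_eq_zero] at this
  have h2 : w ∉ H.nbhd v := by simp [this]
  simpa using h2

/-- The number of edges between two sets, counted by endpoints. -/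
noncomputable def cnt (H : SimpleGraph V) (X Y : Finset V) : ℕ := ∑ x ∈ X, #(H.nbhd x ∩ Y)

theorem cnt_comm (H : SimpleGraph V) (X Y : Finset V) : H.cnt X Y = H.cnt Y X := by
  have := sum_card_bipartiteAbove_eq_sum_card_bipartiteBelow (s := X) (t := Y) H.Adj
  simp only [bipartiteAbove, bipartiteBelow] at this
  rw [cnt, cnt]
  convert this using 2 with x hx x hx
  · congr 1
    ext w
    simp [and_comm]
  · congr 1
    ext w
    simp [and_comm, adj_comm]

theorem cnt_mono {H K : SimpleGraph V} (h : H ≤ K) (X Y : Finset V) : H.cnt X Y ≤ K.cnt X Y :=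
  sum_le_sum fun x _ => card_le_card (inter_subset_inter_right (nbhd_mono h x))

theorem cnt_union_right (H : SimpleGraph V) (X : Finset V) {Y Z : Finset V} (h : Disjoint Y Z) :
    H.cnt X (Y ∪ Z) = H.cnt X Y + H.cnt X Z := by
  rw [cnt, cnt, cnt, ← sum_add_distrib]
  refine sum_congr rfl fun x _ => ?_
  rw [inter_union_distrib_left, card_union_of_disjoint]
  exact h.mono inter_subset_right inter_subset_right

theorem cnt_union_left (H : SimpleGraph V) {X Y : Finset V} (Z : Finset V) (h : Disjoint X Y) :
    H.cnt (X ∪ Y) Z = H.cnt X Z + H.cnt Y Z := by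
  rw [cnt, sum_union h, cnt, cnt]

theorem cnt_univ_right (H : SimpleGraph V) (X : Finset V) : H.cnt X univ = ∑ x ∈ X, H.valency x := by
  simp [cnt, valency]

/-- One side of a 2-colouring. -/
noncomputable def _root_.boolSide (s : V → Bool) (b : Bool) : Finset V := {v | s v = b}

@[simp] theorem _root_.mem_boolSide {s : V → Bool} {b : Bool} {v : V} :
    v ∈ boolSide s b ↔ s v = b := by
  simp [boolSide]

/-- A bipartite graph has an `f`-factor under the Ore–Ryser condition. -/
theorem Crosses.exists_factor {T : SimpleGraph V} {s : V → Bool} (hs : T.Crosses s) (f : V → ℕ)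
    (hf : ∑ v ∈ boolSide s true, f v = ∑ v ∈ boolSide s false, f v)
    (hT : ∀ W ⊆ boolSide s true, ∀ Y ⊆ boolSide s false,
      ∑ v ∈ W, f v + ∑ v ∈ Y, f v ≤ ∑ v ∈ boolSide s true, f v + T.cnt W Y) :
    ∃ D ≤ T, ∀ v, D.valency v = f v := by
  let E : Finset (V × V) := {e | s e.1 = true ∧ T.Adj e.1 e.2}
  have hmask : ∀ (W : Finset V) b, ∑ v ∈ W, (if s v = b then f v else 0) =
      ∑ v ∈ W ∩ boolSide s b, f v := by
    intro W b
    rw [← sum_filter]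
    congr 1
    ext v
    simp
  obtain ⟨D, hDE, hrow, hcol⟩ := exists_subset_card_row_col E
    (fun v => if s v = true then f v else 0) (fun v => if s v = false then f v else 0)
    (by simpa only [hmask, univ_inter] using hf) (by
      intro W Y
      have h := hT (W ∩ boolSide s true) inter_subset_right (Y ∩ boolSide s false)
        inter_subset_right
      have h2 : T.cnt (W ∩ boolSide s true) (Y ∩ boolSide s false) =
          #{e ∈ E | e.1 ∈ W ∧ e.2 ∈ Y} := by
        rw [cnt, ← card_sigma]
        refine card_nbij' (fun x => (x.1, x.2)) (fun e => ⟨e.1, e.2⟩) ?_ ?_ ?_ ?_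
        · rintro ⟨u, v⟩ h
          simp only [coe_sigma, Set.mem_sigma_iff, mem_coe, mem_inter, mem_nbhd,
            mem_boolSide] at h
          simp only [E, coe_filter, mem_filter, mem_univ, true_and, Set.mem_ofPred_eq]
          tauto
        · rintro ⟨u, v⟩ h
          simp only [E, coe_filter, mem_filter, mem_univ, true_and, Set.mem_ofPred_eq] at h
          simp only [coe_sigma, Set.mem_sigma_iff, mem_coe, mem_inter, mem_nbhd,
            mem_boolSide]
          have h3 := hs h.1.2
          rw [h.1.1] at h3
          refine ⟨⟨h.2.1, h.1.1⟩, h.1.2, h.2.2, ?_⟩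
          cases hv : s v
          · rfl
          · exact absurd hv.symm h3
        · rintro ⟨u, v⟩ _
          rfl
        · rintro ⟨u, v⟩ _
          rfl
      rw [hmask, hmask, hmask, univ_inter, ← h2]
      exact h)
  have hE : ∀ {u v}, (u, v) ∈ D → s u = true ∧ s v = false ∧ T.Adj u v := by
    intro u v h
    have h1 := (mem_filter.1 (hDE h)).2
    have h3 := hs h1.2
    rw [h1.1] at h3
    refine ⟨h1.1, ?_, h1.2⟩
    cases hv : s v
    · rfl
    · exact absurd hv.symm h3
  let K : SimpleGraph V :=
    { Adj := fun u v => (u, v) ∈ D ∨ (v, u) ∈ D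
      symm := ⟨fun u v h => h.symm⟩
      loopless := ⟨fun u h => by
        rcases h with h | h <;> exact (hE h).2.2.ne rfl⟩ }
  refine ⟨K, ?_, ?_⟩
  · rintro u v (h | h)
    · exact (hE h).2.2
    · exact (hE h).2.2.symm
  · intro v
    cases hv : s v
    · have h1 := hcol v
      simp only [hv, if_true] at h1
      rw [← h1]
      refine (card_nbij' (fun e => e.1) (fun u => (u, v)) ?_ ?_ ?_ ?_).symm
      · rintro ⟨x, y⟩ h
        simp only [coe_filter, Set.mem_ofPred_eq] at h
        obtain ⟨h, rfl⟩ := h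
        simp only [mem_coe, mem_nbhd]
        exact Or.inr h
      · intro u hu
        rw [mem_coe, mem_nbhd] at hu
        rcases hu with hu | hu
        · have := (hE hu).1
          simp [hv] at this
        · simpa using hu
      · rintro ⟨x, y⟩ h
        simp only [coe_filter, Set.mem_ofPred_eq] at h
        simp [h.2]
      · intro u _
        rfl
    · have h1 := hrow v
      simp only [hv, if_true] at h1
      rw [← h1]
      refine (card_nbij' (fun e => e.2) (fun u => (v, u)) ?_ ?_ ?_ ?_).symm
      · rintro ⟨x, y⟩ h
        simp only [coe_filter, Set.mem_ofPred_eq] at h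
        obtain ⟨h, rfl⟩ := h
        simp only [mem_coe, mem_nbhd]
        exact Or.inl h
      · intro u hu
        rw [mem_coe, mem_nbhd] at hu
        rcases hu with hu | hu
        · simpa using hu
        · have := (hE hu).2.1
          simp [hv] at this
      · rintro ⟨x, y⟩ h
        simp only [coe_filter, Set.mem_ofPred_eq] at h
        simp [h.2]
      · intro u _
        rfl

theorem factorable_of_valency_eq_one {M : SimpleGraph V} (h : ∀ v, M.valency v = 1) :
    M.Factorable := by
  refine ⟨{M}, ?_, by simp, by simp⟩
  rintro _ rfl v
  obtain ⟨w, hw⟩ := card_eq_one.1 (h v)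
  refine ⟨w, ?_, fun u hu => ?_⟩
  · exact mem_nbhd.1 (hw ▸ mem_singleton_self w)
  · rwa [← mem_singleton, ← hw, mem_nbhd]

theorem sum_valency_boolSide_eq {H : SimpleGraph V} {s : V → Bool} (hs : H.Crosses s) :
    ∑ v ∈ boolSide s true, H.valency v = ∑ v ∈ boolSide s false, H.valency v := by
  have h : ∀ b, ∑ v ∈ boolSide s b, H.valency v = H.cnt (boolSide s b) (boolSide s !b) := by
    intro b
    refine sum_congr rfl fun v hv => ?_
    rw [valency, inter_eq_left.2]
    intro w hw
    have := hs (mem_nbhd.1 hw)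
    rw [mem_boolSide] at hv ⊢
    cases b <;> cases h : s w <;> simp_all
  rw [h, h, cnt_comm]
  rfl

/-- König's theorem: regular bipartite graphs are 1-factorable. -/
theorem Crosses.factorable_of_regular {s : V → Bool} (k : ℕ) : ∀ {H : SimpleGraph V},
    H.Crosses s → (∀ v, H.valency v = k) → H.Factorable := by
  induction k with
  | zero =>
    intro H _ h
    rw [eq_bot_of_valency_eq_zero h]
    exact factorable_bot
  | succ k ih =>
    intro H hs h
    have hcard : #(boolSide s true) = #(boolSide s false) := by
      have := sum_valency_boolSide_eq hs
      simp only [h, sum_const, smul_eq_mul] at this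
      exact Nat.eq_of_mul_eq_mul_right k.succ_pos this
    -- Of the (k + 1)|W| edges at `W`, those missing `Y` end in the rest of the false side, which
    -- receives at most k + 1 per vertex.
    obtain ⟨M, hM, hM1⟩ := hs.exists_factor (fun _ => 1) (by simpa using hcard) (by
      intro W hW Y hY
      simp only [sum_const, smul_eq_mul, mul_one]
      have h1 : H.cnt W Y + H.cnt W (boolSide s false \ Y) = (k + 1) * #W := by
        rw [← cnt_union_right _ _ disjoint_sdiff, union_sdiff_of_subset hY]
        have h2 : H.cnt W (boolSide s false) = ∑ v ∈ W, H.valency v := by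
          refine sum_congr rfl fun v hv => ?_
          rw [valency, inter_eq_left.2]
          intro w hw
          have := hs (mem_nbhd.1 hw)
          have h3 := mem_boolSide.1 (hW hv)
          rw [mem_boolSide]
          cases h : s w <;> simp_all
        rw [h2, sum_congr rfl fun v _ => h v, sum_const, smul_eq_mul, mul_comm]
      have h2 : H.cnt W (boolSide s false \ Y) ≤ (k + 1) * #(boolSide s false \ Y) := by
        rw [cnt_comm, cnt, mul_comm, ← smul_eq_mul, ← sum_const]
        exact sum_le_sum fun v _ => (card_le_card inter_subset_left).trans (h v).le
      have h3 : #(boolSide s false \ Y) + #Y = #(boolSide s false) := card_sdiff_add_card_eq_card hY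
      rw [hcard]
      by_contra hc
      push Not at hc
      have h4 : #(boolSide s false \ Y) + H.cnt W Y < #W := by omega
      have h5 : (k + 1) * (#(boolSide s false \ Y) + H.cnt W Y + 1) ≤ (k + 1) * #W :=
        Nat.mul_le_mul_left _ h4
      have h6 : 1 * H.cnt W Y ≤ (k + 1) * H.cnt W Y := Nat.mul_le_mul_right _ (by omega)
      nlinarith)
    have h1 : (H \ M).Factorable := ih (hs.mono sdiff_le) fun v => by
      have := valency_sdiff hM v
      rw [h, hM1] at this
      omega
    rw [← sup_sdiff_cancel_right hM]
    exact (factorable_of_valency_eq_one hM1).sup h1 disjoint_sdiff_self_right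

end SimpleGraph

end Factors

/-! ### Completing a sparse graph from the reservoir. -/

section Absorption

open Finset
open scoped Classical

namespace SimpleGraph

variable {V : Type*}

/-- The edges of `H` joining different sides of `s`. -/
def cut (H : SimpleGraph V) (s : V → Bool) : SimpleGraph V where
  Adj u v := H.Adj u v ∧ s u ≠ s v
  symm := ⟨fun _ _ h => ⟨h.1.symm, h.2.symm⟩⟩
  loopless := ⟨fun _ h => h.2 rfl⟩

theorem cut_le (H : SimpleGraph V) (s : V → Bool) : H.cut s ≤ H := fun _ _ h => h.1

theorem cut_crosses (H : SimpleGraph V) (s : V → Bool) : (H.cut s).Crosses s := fun _ _ h => h.2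

variable [Fintype V]

/-- The upper half of the expander mixing lemma for a `d`-regular graph with second eigenvalue at
most `d / 12`, with the geometric mean of the sizes replaced by the arithmetic mean. -/
def Mixing (G : SimpleGraph V) (d : ℕ) : Prop := ∀ X Y : Finset V,
  (G.cnt X Y : ℝ) ≤ d * #X * #Y / Fintype.card V + d / 24 * (#X + #Y)

/-- The vertices with given colours in two 2-colourings. -/
noncomputable def _root_.boolPart (s₀ s : V → Bool) (b c : Bool) : Finset V :=
  {v | s₀ v = b ∧ s v = c}

@[simp] theorem _root_.mem_boolPart {s₀ s : V → Bool} {b c : Bool} {v : V} :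
    v ∈ boolPart s₀ s b c ↔ s₀ v = b ∧ s v = c := by
  simp [boolPart]

/-- If f(W) > f(Z), then |Z| ≤ 1.1|W|, and mixing allows at most (0.1381 + 2.1/24) d|W| = 0.2256
d|W| edges from `W` to `Z`. Of the 0.24 d|W| edges from `W` into `Q`, at least 0.014 d|W| ≥ f(W)
therefore avoid `Z`. -/
theorem Mixing.sum_le_sum_add_cnt {G T : SimpleGraph V} {d : ℕ} (hG : G.Mixing d) (hT : T ≤ G)
    {W Q Z : Finset V} (hZ : Z ⊆ Q) (f : V → ℕ) (f₀ : ℕ) (hf₀ : ∀ v, f₀ ≤ f v)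
    (hf₁ : ∀ v, (f v : ℝ) ≤ 1.1 * f₀) (hf₂ : (1.1 : ℝ) * f₀ ≤ 0.014 * d)
    (hdeg : ∀ v ∈ W, (0.24 : ℝ) * d ≤ #(T.nbhd v ∩ Q))
    (hcard : (#Z : ℝ) ≤ 0.1381 * Fintype.card V) :
    ∑ v ∈ W, f v ≤ ∑ v ∈ Z, f v + T.cnt W (Q \ Z) := by
  by_cases hWZ : ∑ v ∈ W, f v ≤ ∑ v ∈ Z, f v
  · omega
  push Not at hWZ
  have h1 : (f₀ : ℝ) * #Z ≤ ∑ v ∈ Z, (f v : ℝ) := by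
    rw [mul_comm, ← nsmul_eq_mul]
    exact card_nsmul_le_sum _ _ _ fun v _ => by exact_mod_cast hf₀ v
  have h2 : ∑ v ∈ W, (f v : ℝ) ≤ 1.1 * f₀ * #W := by
    rw [mul_comm, ← nsmul_eq_mul]
    exact sum_le_card_nsmul _ _ _ fun v _ => hf₁ v
  have h3 : ∑ v ∈ Z, (f v : ℝ) < ∑ v ∈ W, (f v : ℝ) := by exact_mod_cast hWZ
  have h4 : (#Z : ℝ) ≤ 1.1 * #W := by
    by_contra hc
    push Not at hc
    have : (0 : ℝ) ≤ f₀ := Nat.cast_nonneg _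
    nlinarith
  have h5 : (0.24 : ℝ) * d * #W ≤ T.cnt W Q := by
    rw [cnt, mul_comm, ← nsmul_eq_mul]
    push_cast
    exact card_nsmul_le_sum _ _ _ hdeg
  have h6 : (T.cnt W Q : ℝ) = T.cnt W (Q \ Z) + T.cnt W Z := by
    rw [← Nat.cast_add, ← cnt_union_right _ _ sdiff_disjoint, sdiff_union_of_subset hZ]
  have h7 : (T.cnt W Z : ℝ) ≤ d * #W * #Z / Fintype.card V + d / 24 * (#W + #Z) :=
    le_trans (by exact_mod_cast cnt_mono hT W Z) (hG W Z)
  have h8 : (d : ℝ) * #W * #Z / Fintype.card V ≤ d * #W * 0.1381 := by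
    rcases Nat.eq_zero_or_pos (Fintype.card V) with h0 | h0
    · rw [h0]
      simp only [Nat.cast_zero, div_zero]
      positivity
    · rw [div_le_iff₀ (by exact_mod_cast h0), mul_assoc (_ * _)]
      exact mul_le_mul_of_nonneg_left hcard (by positivity)
  have h9 : (d : ℝ) / 24 * (#W + #Z) ≤ d / 24 * (2.1 * #W) :=
    mul_le_mul_of_nonneg_left (by linarith) (by positivity)
  have h10 : (1.1 : ℝ) * f₀ * #W ≤ 0.014 * d * #W :=
    mul_le_mul_of_nonneg_right hf₂ (Nat.cast_nonneg _)
  have h11 : (0 : ℝ) ≤ d * #W := by positivity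
  have h12 : ∑ v ∈ W, (f v : ℝ) ≤ T.cnt W (Q \ Z) := by nlinarith
  have h13 : ∑ v ∈ W, f v ≤ T.cnt W (Q \ Z) := by exact_mod_cast h12
  omega

/-- If `Q \ Y` is small, the previous bound applies to `W`. Otherwise f(W) > f(Q \ Y), the only case
of interest, gives |W| > (0.1381/1.1) n; then `P \ W` is small and the bound applies to `Y`. The
threshold 0.1381 must lie between 0.251 · 1.1/2.1 ≈ 0.1315 for this and 0.24 - 2.1/24 - 0.014 =
0.1385 for the previous bound. -/
theorem Mixing.sum_add_sum_le {G T : SimpleGraph V} {d : ℕ} (hG : G.Mixing d) (hT : T ≤ G)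
    {P Q W Y : Finset V} (hW : W ⊆ P) (hY : Y ⊆ Q)
    (hP : (#P : ℝ) ≤ 0.251 * Fintype.card V)
    (f : V → ℕ) (f₀ : ℕ) (hf₀ : ∀ v, f₀ ≤ f v)
    (hf₁ : ∀ v, (f v : ℝ) ≤ 1.1 * f₀) (hf₂ : (1.1 : ℝ) * f₀ ≤ 0.014 * d)
    (hfPQ : ∑ v ∈ P, f v = ∑ v ∈ Q, f v)
    (hdegP : ∀ v ∈ P, (0.24 : ℝ) * d ≤ #(T.nbhd v ∩ Q))
    (hdegQ : ∀ v ∈ Q, (0.24 : ℝ) * d ≤ #(T.nbhd v ∩ P)) :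
    ∑ v ∈ W, f v + ∑ v ∈ Y, f v ≤ ∑ v ∈ P, f v + T.cnt W Y := by
  have hYQ : ∑ v ∈ Q \ Y, f v + ∑ v ∈ Y, f v = ∑ v ∈ Q, f v := sum_sdiff hY
  have hWP : ∑ v ∈ P \ W, f v + ∑ v ∈ W, f v = ∑ v ∈ P, f v := sum_sdiff hW
  by_cases hZ : (#(Q \ Y) : ℝ) ≤ 0.1381 * Fintype.card V
  · have := hG.sum_le_sum_add_cnt hT (sdiff_subset (s := Q) (t := Y)) f f₀ hf₀ hf₁ hf₂
      (fun v hv => hdegP v (hW hv)) hZ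
    rw [Finset.sdiff_sdiff_eq_self hY] at this
    omega
  · by_cases hWZ : ∑ v ∈ W, f v ≤ ∑ v ∈ Q \ Y, f v
    · omega
    push Not at hWZ hZ
    have h1 : (f₀ : ℝ) * #(Q \ Y) ≤ ∑ v ∈ Q \ Y, (f v : ℝ) := by
      rw [mul_comm, ← nsmul_eq_mul]
      exact card_nsmul_le_sum _ _ _ fun v _ => by exact_mod_cast hf₀ v
    have h2 : ∑ v ∈ W, (f v : ℝ) ≤ 1.1 * f₀ * #W := by
      rw [mul_comm, ← nsmul_eq_mul]
      exact sum_le_card_nsmul _ _ _ fun v _ => hf₁ v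
    have h3 : ∑ v ∈ Q \ Y, (f v : ℝ) < ∑ v ∈ W, (f v : ℝ) := by exact_mod_cast hWZ
    have h4 : (#(Q \ Y) : ℝ) ≤ 1.1 * #W := by
      by_contra hc
      push Not at hc
      have : (0 : ℝ) ≤ f₀ := Nat.cast_nonneg _
      nlinarith
    have h5 : (#(P \ W) : ℝ) + #W = #P := by exact_mod_cast card_sdiff_add_card_eq_card hW
    have h6 : (0 : ℝ) ≤ Fintype.card V := Nat.cast_nonneg _
    have := hG.sum_le_sum_add_cnt hT (sdiff_subset (s := P) (t := W)) f f₀ hf₀ hf₁ hf₂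
      (fun v hv => hdegQ v (hY hv)) (by nlinarith)
    rw [Finset.sdiff_sdiff_eq_self hW, cnt_comm] at this
    omega

/-- A sparse bipartite graph `H`, lying inside the sides of `s₀`, is completed to a regular
bipartite graph by edges of a dense reservoir `R` across `s₀`. -/
theorem Mixing.exists_completion {G R H : SimpleGraph V} {d : ℕ} {s₀ s : V → Bool}
    (hG : G.Mixing d) (hRG : R ≤ G) (hR : R.Crosses s₀)
    (hH : ∀ ⦃u v⦄, H.Adj u v → s₀ u = s₀ v) (hHs : H.Crosses s)
    (hs₀ : #(boolSide s₀ true) = #(boolSide s₀ false))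
    (hs : #(boolSide s true) = #(boolSide s false))
    (hbal : ∑ v ∈ boolSide s₀ true, H.valency v = ∑ v ∈ boolSide s₀ false, H.valency v)
    (hdeg : ∀ v, (0.24 : ℝ) * d ≤ (R.cut s).valency v)
    (hpart : ∀ b c, (#(boolPart s₀ s b c) : ℝ) ≤ 0.251 * Fintype.card V)
    {h f₀ : ℕ} (hf₀ : ∀ v, H.valency v + f₀ ≤ h) (hf₁ : ∀ v, (h : ℝ) ≤ H.valency v + 1.1 * f₀)
    (hf₂ : (1.1 : ℝ) * f₀ ≤ 0.014 * d) :
    ∃ D ≤ R, D.Crosses s ∧ ∀ v, H.valency v + D.valency v = h := by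
  -- The degrees `D` has to supply. Edges of `R` crossing `s` change both colours, so they form two
  -- bipartite graphs, each joining a part (b, c) to the opposite part (!b, !c). The Ore–Ryser
  -- condition is checked on each and added up.
  let f : V → ℕ := fun v => h - H.valency v
  have hle : ∀ v, H.valency v ≤ h := fun v => (Nat.le_add_right _ _).trans (hf₀ v)
  have hsplit₀ : ∀ b, boolSide s₀ b = boolPart s₀ s b true ∪ boolPart s₀ s b false := by
    intro b
    ext v
    cases hv : s v <;> simp [hv]
  have hsplit : ∀ c, boolSide s c = boolPart s₀ s true c ∪ boolPart s₀ s false c := by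
    intro b
    ext v
    cases hv : s₀ v <;> simp [hv]
  have hdis : ∀ b c b' c', (b ≠ b' ∨ c ≠ c') →
      Disjoint (boolPart s₀ s b c) (boolPart s₀ s b' c') := by
    intro b c b' c' hne
    rw [Finset.disjoint_left]
    intro v hv hv'
    rw [mem_boolPart] at hv hv'
    rcases hne with hne | hne
    · exact hne (hv.1.symm.trans hv'.1)
    · exact hne (hv.2.symm.trans hv'.2)
  have hdis₀ : ∀ b, Disjoint (boolPart s₀ s b true) (boolPart s₀ s b false) :=
    fun b => hdis _ _ _ _ (Or.inr (by simp))
  have hdis₁ : ∀ c, Disjoint (boolPart s₀ s true c) (boolPart s₀ s false c) :=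
    fun b => hdis _ _ _ _ (Or.inl (by simp))
  have hcard : ∀ c, #(boolPart s₀ s true c) = #(boolPart s₀ s false !c) := by
    rw [hsplit₀, hsplit₀, card_union_of_disjoint (hdis₀ _), card_union_of_disjoint (hdis₀ _)]
      at hs₀
    rw [hsplit, hsplit, card_union_of_disjoint (hdis₁ _), card_union_of_disjoint (hdis₁ _)] at hs
    intro c
    cases c
    · show #(boolPart s₀ s true false) = #(boolPart s₀ s false true)
      omega
    · show #(boolPart s₀ s true true) = #(boolPart s₀ s false false)
      omega
  -- `H` keeps to the sides of `s₀` and crosses `s`. With `hbal` it follows that opposite parts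
  -- demand equally much.
  have hval : ∀ b, ∑ v ∈ boolPart s₀ s b true, H.valency v =
      ∑ v ∈ boolPart s₀ s b false, H.valency v := by
    intro b
    have h1 : ∀ c, ∑ v ∈ boolPart s₀ s b c, H.valency v =
        H.cnt (boolPart s₀ s b c) (boolPart s₀ s b !c) := by
      intro c
      refine sum_congr rfl fun v hv => ?_
      rw [valency, inter_eq_left.2]
      intro w hw
      rw [mem_nbhd] at hw
      rw [mem_boolPart] at hv ⊢
      refine ⟨(hH hw).symm.trans hv.1, ?_⟩
      have := hHs hw
      rw [hv.2] at this
      exact Bool.eq_not.2 this.symm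
    rw [h1, h1, cnt_comm]
    rfl
  have hvalsum : ∀ c, ∑ v ∈ boolPart s₀ s true c, H.valency v =
      ∑ v ∈ boolPart s₀ s false !c, H.valency v := by
    rw [hsplit₀, hsplit₀, sum_union (hdis₀ _), sum_union (hdis₀ _)] at hbal
    have h1 := hval true
    have h2 := hval false
    intro c
    cases c
    · show ∑ v ∈ boolPart s₀ s true false, H.valency v = ∑ v ∈ boolPart s₀ s false true, H.valency v
      omega
    · show ∑ v ∈ boolPart s₀ s true true, H.valency v = ∑ v ∈ boolPart s₀ s false false, H.valency v
      omega
  have hfsum : ∀ X : Finset V, ∑ v ∈ X, f v + ∑ v ∈ X, H.valency v = #X * h := by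
    intro X
    rw [← sum_add_distrib, ← smul_eq_mul, ← sum_const]
    exact sum_congr rfl fun v _ => Nat.sub_add_cancel (hle v)
  have hfPQ : ∀ c, ∑ v ∈ boolPart s₀ s true c, f v = ∑ v ∈ boolPart s₀ s false !c, f v := by
    intro c
    have h1 := hfsum (boolPart s₀ s true c)
    have h2 := hfsum (boolPart s₀ s false !c)
    rw [hvalsum, hcard] at h1
    omega
  have hnb : ∀ b c, ∀ v ∈ boolPart s₀ s b c,
      (0.24 : ℝ) * d ≤ #((R.cut s).nbhd v ∩ boolPart s₀ s (!b) (!c)) := by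
    intro b c v hv
    rw [inter_eq_left.2]
    · exact hdeg v
    · intro w hw
      rw [mem_nbhd] at hw
      rw [mem_boolPart] at hv ⊢
      have h1 := hR hw.1
      have h2 := hw.2
      rw [hv.1] at h1
      rw [hv.2] at h2
      exact ⟨Bool.eq_not.2 h1.symm, Bool.eq_not.2 h2.symm⟩
  have hfv₀ : ∀ v, f₀ ≤ f v := fun v => by have := hf₀ v; simp only [f]; omega
  have hfv₁ : ∀ v, (f v : ℝ) ≤ 1.1 * f₀ := fun v => by
    have := hf₁ v
    simp only [f]
    rw [Nat.cast_sub (hle v)]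
    linarith
  have hmain : ∀ c, ∀ W ⊆ boolPart s₀ s true c, ∀ Y ⊆ boolPart s₀ s false !c,
      ∑ v ∈ W, f v + ∑ v ∈ Y, f v ≤ ∑ v ∈ boolPart s₀ s true c, f v + (R.cut s).cnt W Y := by
    intro c W hW Y hY
    refine hG.sum_add_sum_le ((R.cut_le s).trans hRG) hW hY (hpart _ _) f f₀ hfv₀ hfv₁
      hf₂ (hfPQ c) (hnb true c) ?_
    have := hnb false (!c)
    simpa using this
  obtain ⟨D, hD, hDf⟩ := (R.cut_crosses s).exists_factor f (by
      have h1 := hfPQ true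
      have h2 := hfPQ false
      simp only [Bool.not_true, Bool.not_false] at h1 h2
      rw [hsplit, hsplit, sum_union (hdis₁ _), sum_union (hdis₁ _)]
      omega) (by
      intro W hW Y hY
      have hWs : W = W ∩ boolPart s₀ s true true ∪ W ∩ boolPart s₀ s false true := by
        rw [← inter_union_distrib_left, ← hsplit, inter_eq_left.2 hW]
      have hYs : Y = Y ∩ boolPart s₀ s true false ∪ Y ∩ boolPart s₀ s false false := by
        rw [← inter_union_distrib_left, ← hsplit, inter_eq_left.2 hY]
      set W₁ := W ∩ boolPart s₀ s true true
      set W₂ := W ∩ boolPart s₀ s false true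
      set Y₁ := Y ∩ boolPart s₀ s true false
      set Y₂ := Y ∩ boolPart s₀ s false false
      have hdW : Disjoint W₁ W₂ := (hdis₁ true).mono inter_subset_right inter_subset_right
      have hdY : Disjoint Y₁ Y₂ := (hdis₁ false).mono inter_subset_right inter_subset_right
      have h1 := hmain true W₁ inter_subset_right Y₂ inter_subset_right
      have h2 := hmain false Y₁ inter_subset_right W₂ inter_subset_right
      have h3 := hfPQ false
      simp only [Bool.not_false] at h3
      rw [cnt_comm] at h2
      rw [hWs, hYs, cnt_union_left _ _ hdW, cnt_union_right _ _ hdY, cnt_union_right _ _ hdY,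
        hsplit, sum_union hdW, sum_union hdY, sum_union (hdis₁ _)]
      omega)
  exact ⟨D, hD.trans (R.cut_le s), (R.cut_crosses s).mono hD, fun v => by
    rw [hDf]
    exact Nat.add_sub_cancel' (hle v)⟩

end SimpleGraph

end Absorption

/-! ### Degree-bounded subgraphs, balancing, and pairings. -/

section Subgraphs

open Finset
open scoped Classical

namespace SimpleGraph

variable {V : Type*}

/-- The edges of `H` with both ends on the side `b` of `s`. -/
def within (H : SimpleGraph V) (s : V → Bool) (b : Bool) : SimpleGraph V where
  Adj u v := H.Adj u v ∧ s u = b ∧ s v = b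
  symm := ⟨fun _ _ h => ⟨h.1.symm, h.2.2, h.2.1⟩⟩
  loopless := ⟨fun _ h => h.1.ne rfl⟩

/-- Every edge of `H` joins two vertices on the same side of `s`. -/
def Inside (H : SimpleGraph V) (s : V → Bool) : Prop := ∀ ⦃u v⦄, H.Adj u v → s u = s v

theorem Inside.mono {H K : SimpleGraph V} {s : V → Bool} (hK : K.Inside s) (h : H ≤ K) :
    H.Inside s := fun _ _ huv => hK (h huv)

theorem within_le (H : SimpleGraph V) (s : V → Bool) (b : Bool) : H.within s b ≤ H :=
  fun _ _ h => h.1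

variable [Fintype V]

theorem valency_edge {u v : V} (h : u ≠ v) (w : V) :
    (edge u v).valency w = if w = u ∨ w = v then 1 else 0 := by
  split_ifs with hw
  · rw [valency, card_eq_one]
    rcases hw with rfl | rfl
    · exact ⟨v, by ext x; simp [edge_adj]; grind⟩
    · exact ⟨u, by ext x; simp [edge_adj]; grind⟩
  · rw [valency, card_eq_zero]
    ext x
    simp [edge_adj]
    grind

/-- A subgraph with degrees at most `q` extends to a maximal one. -/
theorem exists_maximal_valency_le {S₀ K : SimpleGraph V} {q : ℕ} (hS₀ : S₀ ≤ K)
    (hq : ∀ v, S₀.valency v ≤ q) :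
    ∃ S, S₀ ≤ S ∧ S ≤ K ∧ (∀ v, S.valency v ≤ q) ∧
      ∀ u v, K.Adj u v → ¬ S.Adj u v → S.valency u = q ∨ S.valency v = q := by
  obtain ⟨S, hS⟩ := (Set.toFinite {S | S₀ ≤ S ∧ S ≤ K ∧ ∀ v, S.valency v ≤ q}).exists_maximal
    ⟨S₀, le_rfl, hS₀, hq⟩
  obtain ⟨⟨h1, h2, h3⟩, hmax⟩ := hS
  refine ⟨S, h1, h2, h3, fun u v huv hS => ?_⟩
  by_contra hc
  push Not at hc
  have hdis : Disjoint S (edge u v) := by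
    rw [disjoint_left]
    intro x y hxy hxy'
    rw [edge_adj] at hxy'
    rcases hxy'.1 with ⟨rfl, rfl⟩ | ⟨rfl, rfl⟩
    · exact hS hxy
    · exact hS hxy.symm
  have hle : S ⊔ edge u v ≤ S := by
    refine hmax ⟨h1.trans le_sup_left, sup_le h2 ?_, fun w => ?_⟩ le_sup_left
    · intro x y hxy
      rw [edge_adj] at hxy
      rcases hxy.1 with ⟨rfl, rfl⟩ | ⟨rfl, rfl⟩
      · exact huv
      · exact huv.symm
    · rw [valency_sup_of_disjoint hdis, valency_edge huv.ne]
      have := h3 w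
      split_ifs with hw
      · rcases hw with rfl | rfl
        · have := hc.1
          omega
        · have := hc.2
          omega
      · omega
  exact hS (hle (Or.inr (by simp [edge_adj, huv.ne])))

theorem sum_valency (H : SimpleGraph V) : ∑ v, H.valency v = 2 * H.edgeSet.ncard := by
  rw [Set.ncard_eq_toFinset_card', ← edgeFinset, ← sum_degrees_eq_twice_card_edges]
  refine sum_congr rfl fun v _ => ?_
  rw [valency, degree]
  congr 1
  ext w
  simp

theorem exists_le_sum_valency_eq (H : SimpleGraph V) {x : ℕ} (hx : 2 * x ≤ ∑ v, H.valency v) :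
    ∃ S ≤ H, ∑ v, S.valency v = 2 * x := by
  rw [sum_valency] at hx
  obtain ⟨t, ht, htx⟩ := Set.exists_subset_card_eq (s := H.edgeSet) (n := x) (by omega)
  refine ⟨fromEdgeSet t, ?_, ?_⟩
  · intro u v huv
    exact ht ((fromEdgeSet_adj t).1 huv).1
  · rw [sum_valency, edgeSet_fromEdgeSet, sdiff_eq_left.2, htx]
    rw [Set.disjoint_left]
    intro e he hd
    exact H.not_isDiag_of_mem_edgeSet (ht he) hd

/-- A subgraph of maximum degree `q` with a share of about `q / (2 Δ)` of the edges. -/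
theorem exists_le_valency_le_large (K : SimpleGraph V) (q Δ : ℕ) (hΔ : ∀ v, K.valency v ≤ Δ) :
    ∃ S ≤ K, (∀ v, S.valency v ≤ q) ∧
      q * ∑ v, K.valency v ≤ (q + 2 * Δ) * ∑ v, S.valency v := by
  obtain ⟨S, -, hSK, hSq, hS⟩ := exists_maximal_valency_le (S₀ := ⊥) (K := K) (q := q) bot_le
    (by simp)
  refine ⟨S, hSK, hSq, ?_⟩
  -- By maximality the saturated vertices cover all edges of `K \ S`, whose degree sum is thus at
  -- most 2|U|Δ, while `S` has degree sum at least q|U|.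
  let U : Finset V := {v | S.valency v = q}
  have h1 : #U * q ≤ ∑ v, S.valency v := by
    rw [← smul_eq_mul]
    exact (card_nsmul_le_sum U _ q fun v hv => (mem_filter.1 hv).2.ge).trans
      (sum_le_sum_of_subset (subset_univ U))
  have h2 : ∑ v ∈ U, (K \ S).valency v ≤ #U * Δ := by
    rw [← smul_eq_mul]
    exact sum_le_card_nsmul _ _ _ fun v _ => (valency_mono sdiff_le v).trans (hΔ v)
  have h3 : ∑ v ∈ Uᶜ, (K \ S).valency v ≤ ∑ v ∈ U, (K \ S).valency v := by
    calc ∑ v ∈ Uᶜ, (K \ S).valency v = (K \ S).cnt Uᶜ U := by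
          refine sum_congr rfl fun v hv => ?_
          rw [valency, inter_eq_left.2]
          intro w hw
          rw [mem_nbhd, sdiff_adj] at hw
          rcases hS v w hw.1 hw.2 with h | h
          · simp [U, h] at hv
          · simp [U, h]
      _ = (K \ S).cnt U Uᶜ := cnt_comm _ _ _
      _ ≤ _ := sum_le_sum fun v _ => card_le_card inter_subset_left
  have h4 : ∑ v, K.valency v = ∑ v, S.valency v + ∑ v, (K \ S).valency v := by
    rw [← sum_add_distrib]
    exact sum_congr rfl fun v _ => (valency_sdiff hSK v).symm
  have h5 := sum_add_sum_compl U (K \ S).valency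
  have h6 : q * ∑ v, (K \ S).valency v ≤ q * (2 * (#U * Δ)) := Nat.mul_le_mul_left _ (by omega)
  have h7 : 2 * Δ * (#U * q) ≤ 2 * Δ * ∑ v, S.valency v := Nat.mul_le_mul_left _ h1
  rw [h4]
  nlinarith

theorem sum_boolSide_eq_of_within {H S : SimpleGraph V} {s : V → Bool} {b : Bool}
    (hS : S ≤ H.within s b) : ∑ v ∈ boolSide s b, S.valency v = ∑ v, S.valency v := by
  refine sum_subset (subset_univ _) fun v _ hv => ?_
  rw [valency, card_eq_zero]
  ext w
  simp only [mem_nbhd, notMem_empty, iff_false]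
  exact fun h => hv (mem_boolSide.2 (hS h).2.1)

theorem valency_eq_zero_of_within {H S : SimpleGraph V} {s : V → Bool} {b : Bool}
    (hS : S ≤ H.within s b) {v : V} (hv : s v ≠ b) : S.valency v = 0 := by
  rw [valency, card_eq_zero]
  ext w
  simp only [mem_nbhd, notMem_empty, iff_false]
  exact fun h => hv (hS h).2.1

theorem Inside.valency_within {H : SimpleGraph V} {s : V → Bool} (hH : H.Inside s) {b : Bool}
    {v : V} (hv : s v = b) : (H.within s b).valency v = H.valency v := by
  rw [valency, valency]
  congr 1
  ext w
  simp only [mem_nbhd]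
  exact ⟨fun h => h.1, fun h => ⟨h, hv, (hH h).symm.trans hv⟩⟩

theorem Inside.sum_within {H : SimpleGraph V} {s : V → Bool} (hH : H.Inside s) (b : Bool) :
    ∑ v, (H.within s b).valency v = ∑ v ∈ boolSide s b, H.valency v := by
  rw [← sum_boolSide_eq_of_within le_rfl]
  exact sum_congr rfl fun v hv => hH.valency_within (mem_boolSide.1 hv)

/-- The two sides carry equally many edges of `H`. -/
def Balanced (H : SimpleGraph V) (s : V → Bool) : Prop :=
  ∑ v ∈ boolSide s true, H.valency v = ∑ v ∈ boolSide s false, H.valency v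

/-- Each side's degree sum is twice its number of edges, so the surplus is even and can be removed
exactly, edge by edge. -/
theorem Inside.exists_balanced {H B : SimpleGraph V} {s : V → Bool} (hH : H.Inside s) {b : Bool}
    (hB : B ≤ H.within s b)
    (h1 : ∑ v ∈ boolSide s (!b), H.valency v ≤ ∑ v ∈ boolSide s b, H.valency v)
    (h2 : ∑ v ∈ boolSide s b, H.valency v ≤ ∑ v ∈ boolSide s (!b), H.valency v +
      ∑ v, B.valency v) : ∃ S ≤ B, (H \ S).Balanced s := by
  have e1 := sum_valency (H.within s b)
  have e2 := sum_valency (H.within s !b)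
  rw [hH.sum_within] at e1 e2
  obtain ⟨S, hSB, hS⟩ := B.exists_le_sum_valency_eq
    (x := (H.within s b).edgeSet.ncard - (H.within s !b).edgeSet.ncard) (by omega)
  refine ⟨S, hSB, ?_⟩
  have hSH : S ≤ H := hSB.trans (hB.trans (within_le _ _ _))
  have h3 : ∑ v ∈ boolSide s b, S.valency v + ∑ v ∈ boolSide s b, (H \ S).valency v =
      ∑ v ∈ boolSide s b, H.valency v := by
    rw [← sum_add_distrib]
    exact sum_congr rfl fun v _ => valency_sdiff hSH v
  have h4 : ∑ v ∈ boolSide s (!b), (H \ S).valency v =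
      ∑ v ∈ boolSide s (!b), H.valency v := by
    refine sum_congr rfl fun v hv => ?_
    rw [← valency_sdiff hSH v, valency_eq_zero_of_within (hSB.trans hB), zero_add]
    rw [mem_boolSide] at hv
    simp [hv]
  rw [sum_boolSide_eq_of_within (hSB.trans hB), hS] at h3
  have h5 : ∑ v ∈ boolSide s b, (H \ S).valency v = ∑ v ∈ boolSide s (!b), (H \ S).valency v := by
    omega
  cases b
  · exact h5.symm
  · exact h5

/-- A nearly balanced graph becomes balanced by removing a subgraph of small maximum degree. -/
theorem Inside.exists_balanced_of_nearly {H : SimpleGraph V} {s : V → Bool} (hH : H.Inside s)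
    {q Δ : ℕ} (hq : 0 < q) (hΔ : ∀ v, H.valency v ≤ Δ)
    (h : ∀ b, (∑ v ∈ boolSide s b, H.valency v) * (q + 2 * Δ) ≤
      (∑ v ∈ boolSide s (!b), H.valency v) * (q + 2 * Δ) +
        q * ∑ v ∈ boolSide s b, H.valency v) :
    ∃ S ≤ H, (∀ v, S.valency v ≤ q) ∧ (H \ S).Balanced s := by
  obtain ⟨b, hb⟩ : ∃ b, ∑ v ∈ boolSide s (!b), H.valency v ≤
      ∑ v ∈ boolSide s b, H.valency v := by
    rcases le_total (∑ v ∈ boolSide s true, H.valency v)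
      (∑ v ∈ boolSide s false, H.valency v) with h | h
    · exact ⟨false, h⟩
    · exact ⟨true, h⟩
  obtain ⟨B, hB, hBq, hBsum⟩ := exists_le_valency_le_large (H.within s b) q Δ
    fun v => (valency_mono (within_le _ _ _) v).trans (hΔ v)
  rw [hH.sum_within] at hBsum
  obtain ⟨S, hS, hbal⟩ := hH.exists_balanced hB hb (by
    have := h b
    refine Nat.le_of_mul_le_mul_right (c := q + 2 * Δ) ?_ (by omega)
    nlinarith)
  exact ⟨S, hS.trans (hB.trans (within_le _ _ _)),
    fun v => (valency_mono hS v).trans (hBq v), hbal⟩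

/-- Every matching extends to a pairing of the vertices. -/
theorem exists_pairing_extending {M : SimpleGraph V} (hV : Even (Fintype.card V))
    (hM : ∀ v, M.valency v ≤ 1) :
    ∃ σ : V → V, (∀ v, σ (σ v) = v) ∧ (∀ v, σ v ≠ v) ∧ ∀ u v, M.Adj u v → σ u = v := by
  -- A maximal matching of the complete graph misses at most one vertex, hence none by parity.
  obtain ⟨S, hMS, -, hS1, hS⟩ := exists_maximal_valency_le (K := ⊤) le_top hM
  have hS2 : ∀ v, S.valency v = 1 := by
    by_contra hc
    push Not at hc
    obtain ⟨v, hv⟩ := hc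
    have hv0 : S.valency v = 0 := by have := hS1 v; omega
    have h1 : ∀ w ∈ univ.erase v, S.valency w = 1 := by
      intro w hw
      have hwv := ne_of_mem_erase hw
      by_cases hadj : S.Adj v w
      · rw [valency, card_eq_zero] at hv0
        have : w ∈ S.nbhd v := mem_nbhd.2 hadj
        simp [hv0] at this
      · rcases hS v w hwv.symm hadj with h | h
        · omega
        · exact h
    have h2 := sum_valency S
    rw [← sum_erase_add _ _ (mem_univ v), sum_congr rfl h1, hv0] at h2
    simp only [sum_const, smul_eq_mul, mul_one, card_erase_of_mem (mem_univ v), card_univ] at h2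
    have := Fintype.card_pos_iff.2 ⟨v⟩
    obtain ⟨k, hk⟩ := hV
    omega
  have hex : ∀ v, ∃ w, S.nbhd v = {w} := fun v => card_eq_one.1 (hS2 v)
  choose σ hσ using hex
  have hadj : ∀ v w, S.Adj v w ↔ σ v = w := fun v w => by
    rw [← mem_nbhd, hσ, mem_singleton, eq_comm]
  exact ⟨σ, fun v => (hadj _ _).1 ((hadj v _).2 rfl).symm, fun v h => S.irrefl ((hadj v v).2 h),
    fun u v h => (hadj u v).1 (hMS h)⟩

end SimpleGraph

end Subgraphs

/-! ### Second colourings, and peeling off matchings. -/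

section Splitting

open Finset
open scoped Classical

theorem two_mul_card_filter_eq {V : Type*} (N : Finset V) (s : V → Bool) (c : Bool) :
    (2 : ℝ) * #{u ∈ N | s u = c} = #N + c.sgn * ∑ u ∈ N, (s u).sgn := by
  rw [mul_sum, card_eq_sum_ones, card_eq_sum_ones, sum_filter]
  push_cast
  rw [mul_sum, ← sum_add_distrib]
  refine sum_congr rfl fun u _ => ?_
  cases s u <;> cases c <;> norm_num [Bool.sgn]

theorem card_boolSide_eq_of_pairing {V : Type*} [Fintype V] {s : V → Bool} {σ : V → V}
    (hσ : ∀ v, σ (σ v) = v) (hs : ∀ v, s (σ v) = !(s v)) :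
    #(boolSide s true) = #(boolSide s false) := by
  refine card_nbij' σ σ ?_ ?_ (fun v _ => hσ v) (fun v _ => hσ v)
  · intro v hv
    rw [mem_coe, mem_boolSide] at hv ⊢
    simp [hs, hv]
  · intro v hv
    rw [mem_coe, mem_boolSide] at hv ⊢
    simp [hs, hv]

namespace SimpleGraph

variable {V : Type*}

theorem disjoint_of_crosses_of_inside {R L : SimpleGraph V} {s : V → Bool} (hR : R.Crosses s)
    (hL : L.Inside s) : Disjoint R L := by
  rw [disjoint_left]
  intro u v h1 h2
  exact hR h1 (hL h2)

theorem Factorable.of_sdiff {R L D M : SimpleGraph V} (hRL : Disjoint R L) (hD : D ≤ R)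
    (hM : M ≤ L) (h1 : (M ⊔ D).Factorable) (h2 : ((R \ D) ⊔ (L \ M)).Factorable) :
    (R ⊔ L).Factorable := by
  have e : (M ⊔ D) ⊔ ((R \ D) ⊔ (L \ M)) = R ⊔ L := by
    rw [sup_comm M D, sup_sup_sup_comm, sup_sdiff_cancel_right hD, sup_sdiff_cancel_right hM]
  rw [← e]
  refine h1.sup h2 ?_
  rw [disjoint_sup_left, disjoint_sup_right, disjoint_sup_right]
  exact ⟨⟨(hRL.mono sdiff_le hM).symm, disjoint_sdiff_self_right⟩,
    disjoint_sdiff_self_right, hRL.mono hD sdiff_le⟩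

variable [Fintype V]

theorem abs_two_mul_valency_cut_sub_le {H : SimpleGraph V} {s : V → Bool} {v : V} {x : ℝ}
    (h : |∑ u ∈ H.nbhd v, (s u).sgn| ≤ x) :
    |2 * ((H.cut s).valency v : ℝ) - H.valency v| ≤ x := by
  have h1 : (H.cut s).valency v = #{u ∈ H.nbhd v | s u = !(s v)} := by
    rw [valency]
    congr 1
    ext w
    simp only [cut, mem_nbhd, mem_filter, Bool.eq_not, ne_comm]
  rw [h1, two_mul_card_filter_eq, valency, add_sub_cancel_left, abs_mul, Bool.abs_sgn, one_mul]
  exact h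

/-- A `d`-regular graph with the mixing property and a balanced 2-colouring that nearly halves all
neighbourhoods. -/
structure Frame (G : SimpleGraph V) (d : ℕ) (s₀ : V → Bool) : Prop where
  valency_eq : ∀ v, G.valency v = d
  mixing : G.Mixing d
  card_eq : #(boolSide s₀ true) = #(boolSide s₀ false)
  card_nbhd_le : ∀ v b, (#(G.nbhd v ∩ boolSide s₀ b) : ℝ) ≤ 0.501 * d

/-- Any pairing of the vertices is separated by a 2-colouring that nearly halves two given
subgraphs. -/
theorem exists_cut (ε : ℝ) (hε : 0 < ε) (hε1 : ε ≤ 0.001) : ∃ d₀ : ℕ, ∀ d : ℕ, d₀ ≤ d →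
    ∀ {V : Type} [Fintype V] {G R L : SimpleGraph V} {s₀ : V → Bool} (σ : V → V),
      G.Frame d s₀ → R ≤ G → L ≤ G → (∀ v, σ (σ v) = v) → (∀ v, σ v ≠ v) →
      ∃ s : V → Bool, (∀ v, s (σ v) = !(s v)) ∧ #(boolSide s true) = #(boolSide s false) ∧
        (∀ v, |2 * ((R.cut s).valency v : ℝ) - R.valency v| ≤ ε * d) ∧
        (∀ v, |2 * ((L.cut s).valency v : ℝ) - L.valency v| ≤ ε * d) ∧
        ∀ b c, (#(boolPart s₀ s b c) : ℝ) ≤ 0.251 * Fintype.card V := by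
  obtain ⟨d₀, hd₀⟩ := exists_halving ε hε
  refine ⟨max d₀ 1, fun d hd V _ G R L s₀ σ hG hR hL hσ hσ' => ?_⟩
  have hd1 : 1 ≤ d := (le_max_right _ _).trans hd
  -- Four sets inside each neighbourhood, whence the bound 4d on the degrees in `exists_halving`.
  let N : V → Fin 4 → Finset V := fun v => ![R.nbhd v, L.nbhd v, G.nbhd v ∩ boolSide s₀ true,
    G.nbhd v ∩ boolSide s₀ false]
  have hN : ∀ v i, N v i ⊆ G.nbhd v := by
    intro v i
    fin_cases i
    · exact nbhd_mono hR v
    · exact nbhd_mono hL v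
    · exact inter_subset_left
    · exact inter_subset_left
  obtain ⟨s, hs, hdisc⟩ := hd₀ d ((le_max_left _ _).trans hd) σ
    (fun k : V × Fin 4 => N k.1 k.2) hσ hσ'
    (fun k => (card_le_card (hN k.1 k.2)).trans (hG.valency_eq k.1).le) (by
      intro v
      have h1 : ({k | v ∈ N k.1 k.2} : Finset (V × Fin 4)) ⊆ G.nbhd v ×ˢ univ := by
        rintro ⟨u, i⟩ hk
        simp only [mem_filter, mem_univ, true_and] at hk
        have := mem_nbhd.1 (hN u i hk)
        simp [this.symm]
      refine (card_le_card h1).trans ?_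
      rw [card_product, card_univ, Fintype.card_fin]
      have := hG.valency_eq v
      rw [valency] at this
      omega)
  refine ⟨s, hs, card_boolSide_eq_of_pairing hσ hs,
    fun v => abs_two_mul_valency_cut_sub_le (hdisc (v, 0)),
    fun v => abs_two_mul_valency_cut_sub_le (hdisc (v, 1)), fun b c => ?_⟩
  -- The parts have order n, too large for the local lemma; their sizes come from averaging over
  -- neighbourhoods, which have size d.
  have h1 : ∀ v, (#(G.nbhd v ∩ boolPart s₀ s b c) : ℝ) ≤ 0.251 * d := by
    intro v
    have e1 : G.nbhd v ∩ boolPart s₀ s b c = {u ∈ G.nbhd v ∩ boolSide s₀ b | s u = c} := by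
      ext w
      simp [and_assoc]
    have e2 := two_mul_card_filter_eq (G.nbhd v ∩ boolSide s₀ b) s c
    have e3 : |∑ u ∈ G.nbhd v ∩ boolSide s₀ b, (s u).sgn| ≤ ε * d := by
      cases b
      · exact hdisc (v, 3)
      · exact hdisc (v, 2)
    have e4 : c.sgn * ∑ u ∈ G.nbhd v ∩ boolSide s₀ b, (s u).sgn ≤ ε * d := by
      refine (le_abs_self _).trans ?_
      rw [abs_mul, Bool.abs_sgn, one_mul]
      exact e3
    have e5 := hG.card_nbhd_le v b
    have e6 : ε * d ≤ 0.001 * d := mul_le_mul_of_nonneg_right hε1 (Nat.cast_nonneg _)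
    rw [e1]
    linarith
  have h2 : (d : ℝ) * #(boolPart s₀ s b c) = ∑ v, (#(G.nbhd v ∩ boolPart s₀ s b c) : ℝ) := by
    have := G.cnt_univ_right (boolPart s₀ s b c)
    rw [cnt_comm, sum_congr rfl fun v _ => hG.valency_eq v, sum_const, smul_eq_mul, cnt] at this
    rw [mul_comm]
    exact_mod_cast this.symm
  have h3 : (d : ℝ) * #(boolPart s₀ s b c) ≤ Fintype.card V * (0.251 * d) := by
    rw [h2, ← nsmul_eq_mul]
    exact sum_le_card_nsmul _ _ _ fun v _ => h1 v
  have h4 : (0 : ℝ) < d := by exact_mod_cast hd1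
  nlinarith

/-- The degree sums of `R` on the two sides agree because `R` crosses; regularity passes this on to
`L`. -/
theorem Frame.balanced {G R L : SimpleGraph V} {d r : ℕ} {s₀ : V → Bool} (hG : G.Frame d s₀)
    (hR : R.Crosses s₀) (hreg : ∀ v, R.valency v + L.valency v = r) : L.Balanced s₀ := by
  have h : ∀ b, ∑ v ∈ boolSide s₀ b, R.valency v + ∑ v ∈ boolSide s₀ b, L.valency v =
      #(boolSide s₀ b) * r := by
    intro b
    rw [← sum_add_distrib, ← smul_eq_mul, ← sum_const]
    exact sum_congr rfl fun v _ => hreg v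
  have h1 := h true
  have h2 := h false
  rw [sum_valency_boolSide_eq hR, hG.card_eq] at h1
  rw [Balanced]
  omega

/-- A balanced matching inside the sides such that, on one of the sides, removing it decreases the
degree sum of every edge. -/
theorem exists_balanced_matching {L : SimpleGraph V} {s₀ : V → Bool} (hL : L.Inside s₀) :
    ∃ M ≤ L, (∀ v, M.valency v ≤ 1) ∧ M.Balanced s₀ ∧ ∃ b, ∀ u v, s₀ u = b → (L \ M).Adj u v →
      (L \ M).valency u + (L \ M).valency v + 1 ≤ L.valency u + L.valency v := by
  -- A maximal matching is trimmed on its heavier side only. On the lighter side every remaining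
  -- edge still meets a matched vertex.
  obtain ⟨M, -, hML, hM1, hM⟩ := exists_maximal_valency_le (S₀ := ⊥) (K := L) (q := 1) bot_le
    (by simp)
  have hMi := hL.mono hML
  obtain ⟨b, hb⟩ : ∃ b, ∑ v ∈ boolSide s₀ (!b), M.valency v ≤
      ∑ v ∈ boolSide s₀ b, M.valency v := by
    rcases le_total (∑ v ∈ boolSide s₀ true, M.valency v)
      (∑ v ∈ boolSide s₀ false, M.valency v) with h | h
    · exact ⟨false, h⟩
    · exact ⟨true, h⟩
  obtain ⟨S, hS, hbal⟩ := hMi.exists_balanced (le_refl (M.within s₀ b)) hb (by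
    rw [hMi.sum_within]
    omega)
  have hML' : M \ S ≤ L := sdiff_le.trans hML
  refine ⟨M \ S, hML', fun v => (valency_mono sdiff_le v).trans (hM1 v), hbal, !b,
    fun u v hu huv => ?_⟩
  have hv : s₀ v = !b := (hL huv.1).symm.trans hu
  have hval : ∀ w, s₀ w = (!b) → (M \ S).valency w = M.valency w := by
    intro w hw
    rw [← valency_sdiff (hS.trans (within_le _ _ _)) w, valency_eq_zero_of_within hS, zero_add]
    simp [hw]
  have hnadj : ¬ M.Adj u v := fun h => huv.2 ⟨h, fun h' => by
    have := (hS h').2.1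
    rw [hu] at this
    simp at this⟩
  have h1 := valency_sdiff hML' u
  have h2 := valency_sdiff hML' v
  rw [hval _ hu] at h1
  rw [hval _ hv] at h2
  rcases hM u v huv.1 hnadj with h | h <;> omega

/-- A reservoir across the sides factors together with a sparse graph inside the sides. -/
theorem exists_factorable_of_sparse : ∃ d₀ : ℕ, ∀ d : ℕ, d₀ ≤ d →
    ∀ {V : Type} [Fintype V] {G : SimpleGraph V} {s₀ : V → Bool},
      Even (Fintype.card V) → G.Frame d s₀ → ∀ (N : ℕ) (a : Bool → ℕ) (R L : SimpleGraph V) (r : ℕ),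
      a true + a false ≤ N → R ≤ G → L ≤ G → R.Crosses s₀ → L.Inside s₀ →
      (∀ v, R.valency v + L.valency v = r) →
      (∀ v, (0.485 : ℝ) * d + 11 * N ≤ R.valency v) →
      (∀ u v, L.Adj u v → L.valency u + L.valency v ≤ a (s₀ u)) → (R ⊔ L).Factorable := by
  obtain ⟨d₀, hd₀⟩ := exists_cut 0.001 (by norm_num) le_rfl
  refine ⟨max d₀ 1000, fun d hd V _ G s₀ hV hG N => ?_⟩
  have hd1 : (1000 : ℝ) ≤ d := by exact_mod_cast (le_max_right _ _).trans hd
  have hbot : ∀ (R L : SimpleGraph V) (r : ℕ), R.Crosses s₀ → L = ⊥ →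
      (∀ v, R.valency v + L.valency v = r) → (R ⊔ L).Factorable := by
    rintro R _ r hR rfl hreg
    rw [sup_bot_eq]
    exact hR.factorable_of_regular r fun v => by simpa using hreg v
  have hpos : ∀ {L : SimpleGraph V} {u v : V}, L.Adj u v → 0 < L.valency u :=
    fun h => card_pos.2 ⟨_, mem_nbhd.2 h⟩
  -- Each round lowers the bound on edge degree sums by one on one of the sides, and takes at most
  -- 11 from every reservoir degree.
  induction N with
  | zero =>
    intro a R L r ha _ _ hR _ hreg _ hLa
    refine hbot R L r hR ?_ hreg
    ext u v
    simp only [bot_adj, iff_false]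
    intro h
    have h1 := hLa u v h
    have h2 := hpos h
    have h3 : a (s₀ u) = 0 := by cases s₀ u <;> omega
    omega
  | succ N ih =>
    intro a R L r ha hRG hLG hR hL hreg hRd hLa
    obtain ⟨M, hML, hM1, hMbal, b, hb⟩ := exists_balanced_matching hL
    -- Then side `b` has no edges of `L`, and by balance neither has the other.
    by_cases hab : a b = 0
    · refine hbot R L r hR ?_ hreg
      have hLbal := hG.balanced hR hreg
      have h1 : ∑ v ∈ boolSide s₀ b, L.valency v = 0 := by
        refine sum_eq_zero fun v hv => ?_
        rw [mem_boolSide] at hv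
        by_contra hne
        obtain ⟨w, hw⟩ := card_pos.1 (Nat.pos_of_ne_zero hne)
        have h2 := hLa v w (mem_nbhd.1 hw)
        rw [hv, hab] at h2
        omega
      have h2 : ∀ c, ∑ v ∈ boolSide s₀ c, L.valency v = 0 := by
        rw [Balanced] at hLbal
        intro c
        cases b <;> cases c <;> omega
      refine eq_bot_of_valency_eq_zero fun v => ?_
      exact sum_eq_zero_iff.1 (h2 (s₀ v)) v (mem_boolSide.2 rfl)
    obtain ⟨σ, hσ, hσ', hMσ⟩ := exists_pairing_extending hV hM1
    obtain ⟨s, hs, hscard, hRs, -, hpart⟩ := hd₀ d ((le_max_left _ _).trans hd) σ hG hRG hLG hσ hσ'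
    have hMs : M.Crosses s := by
      intro u v huv
      rw [← hMσ u v huv, hs]
      simp
    -- A matching leaves demands h or h - 1; h = 11 is the least value for which their ratio is at
    -- most 1.1.
    obtain ⟨D, hDR, hDs, hDh⟩ := hG.mixing.exists_completion hRG hR (hL.mono hML) hMs hG.card_eq
      hscard hMbal (fun v => by
        have h1 := (abs_le.1 (hRs v)).1
        have h2 := hRd v
        have h3 : (0 : ℝ) ≤ 11 * (N + 1 : ℕ) := by positivity
        linarith) hpart (h := 11) (f₀ := 10) (fun v => by have := hM1 v; omega)
      (fun v => by
        have : (0 : ℝ) ≤ M.valency v := Nat.cast_nonneg _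
        push_cast
        linarith) (by push_cast; linarith)
    have hRL := disjoint_of_crosses_of_inside hR hL
    have hMD := hRL.symm.mono hML hDR
    refine Factorable.of_sdiff hRL hDR hML ?_ ?_
    · refine Crosses.factorable_of_regular (s := s) 11 ?_ fun v => ?_
      · rintro u v (h | h)
        · exact hMs h
        · exact hDs h
      · rw [valency_sup_of_disjoint hMD, hDh]
    · refine ih (fun c => if c = b then a b - 1 else a c) (R \ D) (L \ M) (r - 11) ?_
        (sdiff_le.trans hRG) (sdiff_le.trans hLG) (hR.mono sdiff_le) (hL.mono sdiff_le) ?_ ?_ ?_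
      · cases b <;> simp only [Bool.false_eq_true, Bool.true_eq_false, if_true, if_false] <;> omega
      · intro v
        have h1 := valency_sdiff hDR v
        have h2 := valency_sdiff hML v
        have h3 := hreg v
        have h4 := hDh v
        omega
      · intro v
        have h1 : (D.valency v : ℝ) + (R \ D).valency v = R.valency v := by
          exact_mod_cast valency_sdiff hDR v
        have h2 : (D.valency v : ℝ) ≤ 11 := by
          have := hDh v
          exact_mod_cast (show D.valency v ≤ 11 by omega)
        have h3 := hRd v
        push_cast at h3
        linarith
      · intro u v huv
        have h0 := hLa u v huv.1
        split_ifs with hu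
        · have := hb u v hu huv
          rw [hu] at h0
          omega
        · have h1 := valency_mono (H := L \ M) sdiff_le u
          have h2 := valency_mono (H := L \ M) sdiff_le v
          omega

end SimpleGraph

end Splitting

/-! ### Repeated halving of the inner graph. -/

section Reduction

open Finset
open scoped Classical

namespace SimpleGraph

/-- A nearly regular graph inside the sides is split by a 2-colouring; one half is completed to a
regular bipartite graph at a small cost to the reservoir. -/
theorem exists_halving_step (ε : ℝ) (hε : 0 < ε) (hε1 : ε ≤ 0.001) : ∃ d₀ : ℕ, ∀ d : ℕ, d₀ ≤ d →
    ∀ {V : Type} [Fintype V] {G R L : SimpleGraph V} {s₀ : V → Bool} {r : ℕ} {θ γ : ℝ},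
      Even (Fintype.card V) → G.Frame d s₀ → R ≤ G → L ≤ G → R.Crosses s₀ → L.Inside s₀ →
      (∀ v, R.valency v + L.valency v = r) → ε ≤ γ → γ ≤ 1e-6 → 100 * γ ≤ θ →
      (∀ v, (0.491 : ℝ) * d ≤ R.valency v) → (∀ v, |(L.valency v : ℝ) - θ * d| ≤ γ * d) →
      ∃ D ≤ R, ∃ H ≤ L, (H ⊔ D).Factorable ∧ (∀ v w, H.valency v + D.valency v =
        H.valency w + D.valency w) ∧ (∀ v, (D.valency v : ℝ) ≤ 112 * γ * d) ∧
        ∀ v, |((L \ H).valency v : ℝ) - θ / 2 * d| ≤ 8 * γ * d := by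
  obtain ⟨d₀, hd₀⟩ := exists_cut ε hε hε1
  obtain ⟨d₁, hd₁⟩ := exists_nat_gt (1 / ε)
  refine ⟨max d₀ d₁, fun d hd V _ G R L s₀ r θ γ hV hG hRG hLG hR hL hreg hγ hγ1 hθ hRd hLd => ?_⟩
  have hεd : 1 ≤ ε * d := by
    have h1 : (d₁ : ℝ) ≤ d := by exact_mod_cast (le_max_right _ _).trans hd
    have h2 := hd₁.trans_le h1
    rw [div_lt_iff₀ hε] at h2
    linarith
  have hd0 : (0 : ℝ) ≤ d := Nat.cast_nonneg _
  set x : ℝ := γ * d with hx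
  set y : ℝ := θ * d with hy
  have hεx : ε * d ≤ x := mul_le_mul_of_nonneg_right hγ hd0
  have hx1 : 1 ≤ x := hεd.trans hεx
  have hxy : 100 * x ≤ y := by nlinarith
  have hxd : x ≤ 1e-6 * d := mul_le_mul_of_nonneg_right hγ1 hd0
  obtain ⟨σ, hσ, hσ', -⟩ := exists_pairing_extending (M := ⊥) hV (by simp)
  obtain ⟨s, hs, hscard, hRs, hLs, hpart⟩ := hd₀ d ((le_max_left _ _).trans hd) σ hG hRG hLG hσ hσ'
  set H₀ := L.cut s with hH₀
  have hH₀L : H₀ ≤ L := cut_le _ _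
  have hH₀i := hL.mono hH₀L
  have hlow : ∀ v, (y - 2 * x) / 2 ≤ (H₀.valency v : ℝ) := fun v => by
    have h1 := (abs_le.1 (hLs v)).1
    have h2 := (abs_le.1 (hLd v)).1
    linarith
  have hup : ∀ v, (H₀.valency v : ℝ) ≤ (y + 2 * x) / 2 := fun v => by
    have h1 := (abs_le.1 (hLs v)).2
    have h2 := (abs_le.1 (hLd v)).2
    linarith
  set Δ := ⌊(y + 2 * x) / 2⌋₊ with hΔdef
  have hΔ : (Δ : ℝ) ≤ (y + 2 * x) / 2 := Nat.floor_le (by linarith)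
  have hΔ' : ∀ v, H₀.valency v ≤ Δ := fun v => Nat.le_floor (hup v)
  -- The two sides of `H₀` differ by a share of at most about 4x/y, while a subgraph of maximum
  -- degree 5x can carry a share of about 5x/y; y ≥ 42x suffices.
  set q := ⌈5 * x⌉₊ with hqdef
  have hq1 : 5 * x ≤ q := Nat.le_ceil _
  have hq2 : (q : ℝ) ≤ 6 * x := by
    have := (Nat.ceil_lt_add_one (show 0 ≤ 5 * x by linarith)).le
    linarith
  obtain ⟨S, hSH, hSq, hbal⟩ := hH₀i.exists_balanced_of_nearly (q := q) (Δ := Δ)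
    (Nat.ceil_pos.2 (by linarith)) hΔ' (by
      intro b
      have hm : #(boolSide s₀ b) = #(boolSide s₀ true) := by
        cases b
        · exact hG.card_eq.symm
        · rfl
      have hm' : #(boolSide s₀ !b) = #(boolSide s₀ true) := by
        cases b
        · rfl
        · exact hG.card_eq.symm
      set m : ℝ := ((#(boolSide s₀ true) : ℕ) : ℝ) with hmdef
      have hm0 : 0 ≤ m := Nat.cast_nonneg _
      have h1 : ∑ v ∈ boolSide s₀ b, (H₀.valency v : ℝ) ≤ m * ((y + 2 * x) / 2) := by
        rw [hmdef, ← hm, ← nsmul_eq_mul]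
        exact sum_le_card_nsmul _ _ _ fun v _ => hup v
      have h2 : m * ((y - 2 * x) / 2) ≤ ∑ v ∈ boolSide s₀ (!b), (H₀.valency v : ℝ) := by
        rw [hmdef, ← hm', ← nsmul_eq_mul]
        exact card_nsmul_le_sum _ _ _ fun v _ => hlow v
      have h3 : m * ((y - 2 * x) / 2) ≤ ∑ v ∈ boolSide s₀ b, (H₀.valency v : ℝ) := by
        rw [hmdef, ← hm, ← nsmul_eq_mul]
        exact card_nsmul_le_sum _ _ _ fun v _ => hlow v
      have h4 : (∑ v ∈ boolSide s₀ b, (H₀.valency v : ℝ)) * (q + 2 * Δ) ≤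
          (∑ v ∈ boolSide s₀ (!b), (H₀.valency v : ℝ)) * (q + 2 * Δ) +
          q * ∑ v ∈ boolSide s₀ b, (H₀.valency v : ℝ) := by
        set X := ∑ v ∈ boolSide s₀ b, (H₀.valency v : ℝ)
        set X' := ∑ v ∈ boolSide s₀ (!b), (H₀.valency v : ℝ)
        have e1 : X - X' ≤ m * (2 * x) := by linarith
        have e2 : (q : ℝ) + 2 * Δ ≤ y + 8 * x := by linarith
        have e3 : (X - X') * (q + 2 * Δ) ≤ m * (2 * x) * (y + 8 * x) :=
          mul_le_mul e1 e2 (by positivity) (by positivity)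
        have e4 : 5 * x * (m * ((y - 2 * x) / 2)) ≤ q * X :=
          mul_le_mul hq1 h3 (mul_nonneg hm0 (by linarith)) (by positivity)
        have e5 : m * (2 * x) * (y + 8 * x) ≤ 5 * x * (m * ((y - 2 * x) / 2)) := by
          have : 0 ≤ m * x * (y - 42 * x) :=
            mul_nonneg (mul_nonneg hm0 (by linarith)) (by linarith)
          nlinarith
        nlinarith
      exact_mod_cast h4)
  set H := H₀ \ S with hH
  have hHH₀ : H ≤ H₀ := sdiff_le
  have hHL : H ≤ L := hHH₀.trans hH₀L
  have hHval : ∀ v, (S.valency v : ℝ) + H.valency v = H₀.valency v := fun v => by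
    exact_mod_cast valency_sdiff hSH v
  have hSq' : ∀ v, (S.valency v : ℝ) ≤ 6 * x := fun v =>
    le_trans (by exact_mod_cast hSq v) hq2
  have hHs : H.Crosses s := (L.cut_crosses s).mono hHH₀
  -- Degrees of `H` lie within 8x below Δ (2x from `H₀`, 6x from `S`), so a base demand of 100x
  -- keeps all demands within a factor 1.1.
  set f₀ := ⌈100 * x⌉₊ with hf₀def
  have hf1 : 100 * x ≤ f₀ := Nat.le_ceil _
  have hf2 : (f₀ : ℝ) ≤ 101 * x := by
    have := (Nat.ceil_lt_add_one (show 0 ≤ 100 * x by linarith)).le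
    linarith
  have hΔlow : (y + 2 * x) / 2 - 1 ≤ Δ := (Nat.sub_one_lt_floor _).le
  have hHΔ : ∀ v, ((Δ + f₀ : ℕ) : ℝ) ≤ H.valency v + 1.1 * f₀ := fun v => by
    have h1 := hHval v
    have h2 := hSq' v
    have h3 := hlow v
    push_cast
    linarith
  obtain ⟨D, hDR, hDs, hDh⟩ := hG.mixing.exists_completion hRG hR (hL.mono hHL) hHs hG.card_eq
    hscard hbal (fun v => by
      have h1 := (abs_le.1 (hRs v)).1
      have h2 := hRd v
      linarith) hpart (h := Δ + f₀) (f₀ := f₀)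
    (fun v => Nat.add_le_add_right ((valency_mono hHH₀ v).trans (hΔ' v)) _) hHΔ (by linarith)
  refine ⟨D, hDR, H, hHL, ?_, fun v w => by rw [hDh, hDh], fun v => ?_, fun v => ?_⟩
  · refine Crosses.factorable_of_regular (s := s) (Δ + f₀) ?_ fun v => ?_
    · rintro u v (h | h)
      · exact hHs h
      · exact hDs h
    · rw [valency_sup_of_disjoint
        ((disjoint_of_crosses_of_inside hR hL).symm.mono hHL hDR), hDh]
  · have h1 : (H.valency v : ℝ) + D.valency v = (Δ + f₀ : ℕ) := by exact_mod_cast hDh v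
    have h2 := hHΔ v
    rw [mul_assoc, ← hx]
    linarith
  -- The new error 8x is x from `L`, x from `H₀`, and 6x from `S`, which goes back into the
  -- remainder.
  · have h1 : (H.valency v : ℝ) + (L \ H).valency v = L.valency v := by
      exact_mod_cast valency_sdiff hHL v
    have h2 := hHval v
    have h3 := hSq' v
    have h4 := hlow v
    have h5 := hup v
    have h6 := abs_le.1 (hLd v)
    have h7 : (0 : ℝ) ≤ S.valency v := Nat.cast_nonneg _
    rw [mul_assoc 8, ← hx, div_mul_eq_mul_div, ← hy, abs_le]
    constructor <;> linarith

/-- A reservoir across the sides factors together with a nearly regular graph inside the sides. -/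
theorem exists_factorable_of_nearly_regular (ε : ℝ) (hε : 0 < ε) (hε1 : ε ≤ 0.001) :
    ∃ d₀ : ℕ, ∀ d : ℕ, d₀ ≤ d →
    ∀ {V : Type} [Fintype V] {G : SimpleGraph V} {s₀ : V → Bool},
      Even (Fintype.card V) → G.Frame d s₀ → ∀ (k : ℕ) (R L : SimpleGraph V) (r : ℕ) (θ γ : ℝ),
      R ≤ G → L ≤ G → R.Crosses s₀ → L.Inside s₀ → (∀ v, R.valency v + L.valency v = r) →
      ε ≤ γ → 8 ^ k * γ ≤ 1e-6 → θ ≤ 2 ^ k / 20000 →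
      (∀ v, (0.491 + 16 * (8 ^ k - 1) * γ) * d ≤ R.valency v) →
      (∀ v, |(L.valency v : ℝ) - θ * d| ≤ γ * d) → (R ⊔ L).Factorable := by
  obtain ⟨d₀, hd₀⟩ := exists_halving_step ε hε hε1
  obtain ⟨d₁, hd₁⟩ := exists_factorable_of_sparse
  refine ⟨max d₀ d₁, fun d hd V _ G s₀ hV hG k => ?_⟩
  have hd0 : (0 : ℝ) ≤ d := Nat.cast_nonneg _
  have hsparse : ∀ (R L : SimpleGraph V) (r : ℕ), R ≤ G → L ≤ G → R.Crosses s₀ → L.Inside s₀ →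
      (∀ v, R.valency v + L.valency v = r) → (∀ v, (0.491 : ℝ) * d ≤ R.valency v) →
      (∀ v, (L.valency v : ℝ) ≤ 1.02e-4 * d) → (R ⊔ L).Factorable := by
    intro R L r hRG hLG hR hL hreg hRd hLd
    -- Δ bounds the degree sum of an edge. The at most 2Δ rounds of peeling cost 22Δ < 0.0045d,
    -- within the gap between 0.491d and 0.485d.
    set Δ := ⌊2.04e-4 * (d : ℝ)⌋₊
    have hΔ : (Δ : ℝ) ≤ 2.04e-4 * d := Nat.floor_le (by positivity)
    refine hd₁ d ((le_max_right _ _).trans hd) hV hG (2 * Δ) (fun _ => Δ) R L r (by omega) hRG hLG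
      hR hL hreg (fun v => ?_) fun u v _ => Nat.le_floor ?_
    · have := hRd v
      push_cast
      linarith
    · have h1 := hLd u
      have h2 := hLd v
      push_cast
      linarith
  -- The errors grow by a factor 8, so k halvings cost 112γ(1 + 8 + ⋯ + 8^(k-1)) = 16(8^k - 1)γ
  -- times d.
  induction k with
  | zero =>
    intro R L r θ γ hRG hLG hR hL hreg hγ hγ1 hθ hRd hLd
    refine hsparse R L r hRG hLG hR hL hreg (fun v => ?_) fun v => ?_
    · simpa using hRd v
    · have h1 := (abs_le.1 (hLd v)).2
      have h2 : γ * d ≤ 1e-6 * d := mul_le_mul_of_nonneg_right (by simpa using hγ1) hd0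
      have h3 : θ * d ≤ 2 ^ 0 / 20000 * d := mul_le_mul_of_nonneg_right hθ hd0
      linarith
  | succ k ih =>
    intro R L r θ γ hRG hLG hR hL hreg hγ hγ1 hθ hRd hLd
    have hγ0 : 0 < γ := hε.trans_le hγ
    have h8 : (1 : ℝ) ≤ 8 ^ k := one_le_pow₀ (by norm_num)
    have hγ2 : 8 * γ ≤ 1e-6 := by
      rw [pow_succ] at hγ1
      nlinarith
    have hRd' : ∀ v, (0.491 : ℝ) * d ≤ R.valency v := fun v => by
      refine le_trans (mul_le_mul_of_nonneg_right ?_ hd0) (hRd v)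
      have : (0 : ℝ) ≤ 16 * (8 ^ (k + 1) - 1) * γ := by
        rw [pow_succ]
        have : (0 : ℝ) ≤ 8 ^ k * 8 - 1 := by linarith
        positivity
      linarith
    -- If this fails, the error rivals the density, but then the degrees of `L` are at most 101γd
    -- and peeling can start at once.
    by_cases hθγ : 100 * γ ≤ θ
    · obtain ⟨D, hDR, H, hHL, hfac, hsum, hD, hLH⟩ := hd₀ d ((le_max_left _ _).trans hd) hV hG hRG
        hLG hR hL hreg hγ (by linarith) hθγ hRd' hLd
      refine Factorable.of_sdiff (disjoint_of_crosses_of_inside hR hL) hDR hHL hfac ?_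
      rcases isEmpty_or_nonempty V with hE | ⟨⟨w⟩⟩
      · rw [eq_bot_of_valency_eq_zero (H := R \ D ⊔ L \ H) fun v => hE.elim v]
        exact factorable_bot
      refine ih (R \ D) (L \ H) (r - (H.valency w + D.valency w)) (θ / 2) (8 * γ)
        (sdiff_le.trans hRG) (sdiff_le.trans hLG) (hR.mono sdiff_le) (hL.mono sdiff_le) ?_
        (by linarith) (by rw [pow_succ] at hγ1; linarith) (by rw [pow_succ] at hθ; linarith) ?_ hLH
      · intro v
        have h1 := valency_sdiff hDR v
        have h2 := valency_sdiff hHL v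
        have h3 := hreg v
        have h4 := hsum v w
        omega
      · intro v
        have h1 : (D.valency v : ℝ) + (R \ D).valency v = R.valency v := by
          exact_mod_cast valency_sdiff hDR v
        have h2 := hRd v
        have h3 := hD v
        rw [pow_succ] at h2
        linarith
    · push Not at hθγ
      refine hsparse R L r hRG hLG hR hL hreg hRd' fun v => ?_
      have h1 := (abs_le.1 (hLd v)).2
      have h2 : γ * d ≤ 1e-6 * d := mul_le_mul_of_nonneg_right (by linarith) hd0
      have h3 : θ * d ≤ 100 * γ * d := mul_le_mul_of_nonneg_right hθγ.le hd0
      linarith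

/-- Regular graphs of even order with the mixing property are 1-factorable. -/
theorem exists_factorable_of_mixing : ∃ d₀ : ℕ, ∀ d : ℕ, d₀ ≤ d →
    ∀ {V : Type} [Fintype V] {G : SimpleGraph V}, Even (Fintype.card V) →
      (∀ v, G.valency v = d) → G.Mixing d → G.Factorable := by
  -- k = 14 is the least number of halvings with 1/2 ≤ 2^k/20000; after them the error has grown to
  -- 1e-6.
  obtain ⟨ε, hε⟩ : ∃ ε : ℝ, ε = 1e-6 / 8 ^ 14 := ⟨_, rfl⟩
  have hε0 : 0 < ε := by rw [hε]; positivity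
  have hε1 : ε ≤ 0.001 := by rw [hε]; norm_num
  obtain ⟨d₀, hd₀⟩ := exists_halving ε hε0
  obtain ⟨d₁, hd₁⟩ := exists_factorable_of_nearly_regular ε hε0 hε1
  refine ⟨max d₀ d₁, fun d hd V _ G hV hreg hmix => ?_⟩
  have hd0 : (0 : ℝ) ≤ d := Nat.cast_nonneg _
  obtain ⟨σ, hσ, hσ', -⟩ := exists_pairing_extending (M := ⊥) hV (by simp)
  obtain ⟨s, hs, hdisc⟩ := hd₀ d ((le_max_left _ _).trans hd) σ G.nbhd hσ hσ'
    (fun v => (hreg v).le) (by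
      intro v
      have : ({k | v ∈ G.nbhd k} : Finset V) = G.nbhd v := by
        ext w
        simp [adj_comm]
      rw [this]
      have := hreg v
      rw [valency] at this
      omega)
  have hcut : ∀ v, |2 * ((G.cut s).valency v : ℝ) - d| ≤ ε * d := fun v => by
    rw [← hreg v]
    nth_rewrite 2 [hreg v]
    exact abs_two_mul_valency_cut_sub_le (hdisc v)
  have hframe : G.Frame d s := by
    refine ⟨hreg, hmix, card_boolSide_eq_of_pairing hσ hs, fun v b => ?_⟩
    have e1 : G.nbhd v ∩ boolSide s b = {u ∈ G.nbhd v | s u = b} := by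
      ext w
      simp
    have e2 := two_mul_card_filter_eq (G.nbhd v) s b
    have e3 : b.sgn * ∑ u ∈ G.nbhd v, (s u).sgn ≤ ε * d := by
      refine (le_abs_self _).trans ?_
      rw [abs_mul, Bool.abs_sgn, one_mul]
      exact hdisc v
    have e4 : (#(G.nbhd v) : ℝ) = d := by exact_mod_cast hreg v
    have e5 : ε * d ≤ 0.001 * d := mul_le_mul_of_nonneg_right hε1 hd0
    rw [e1]
    linarith
  have hval : ∀ v, ((G.cut s).valency v : ℝ) + (G \ G.cut s).valency v = d := fun v => by
    rw [← hreg v]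
    exact_mod_cast valency_sdiff (G.cut_le s) v
  have h := hd₁ d ((le_max_right _ _).trans hd) hV hframe 14 (G.cut s) (G \ G.cut s) d (1 / 2) ε
    (G.cut_le s) sdiff_le (G.cut_crosses s) (fun u v h => by
      by_contra hne
      exact h.2 ⟨h.1, hne⟩) (fun v => by exact_mod_cast hval v) le_rfl
    (by rw [hε]; norm_num) (by norm_num) (fun v => by
      have h1 := (abs_le.1 (hcut v)).1
      have h2 : (0.491 + 16 * (8 ^ 14 - 1) * ε) * d ≤ (1 / 2 - 0.001) * d :=
        mul_le_mul_of_nonneg_right (by rw [hε]; norm_num) hd0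
      have h3 : ε * d ≤ 0.001 * d := mul_le_mul_of_nonneg_right hε1 hd0
      linarith) (fun v => by
      have h1 := abs_le.1 (hcut v)
      have h2 := hval v
      have h3 : 0 ≤ ε * d := by positivity
      rw [abs_le]
      constructor <;> linarith)
  rwa [sup_sdiff_cancel_right (G.cut_le s)] at h

end SimpleGraph

end Reduction

/-! ### The expander mixing lemma. -/

section Spectral

open Finset

namespace SimpleGraph

variable {V : Type*} [Fintype V] [DecidableEq V]

theorem exists_abs_eigenvalues_le (G : SimpleGraph V) [DecidableRel G.Adj]
    (h : 2 ≤ Fintype.card V) : ∃ i₀ : V, ∀ i, i ≠ i₀ →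
      |G.adjMatrix_real_isHermitian.eigenvalues i| ≤ G.spectralLambda h := by
  let e : Fin (Fintype.card V) ≃ V := Fintype.equivOfCardEq (Fintype.card_fin _)
  refine ⟨e ⟨0, by omega⟩, fun i hi => ?_⟩
  have hval : G.adjMatrix_real_isHermitian.eigenvalues i = G.adjEigenvalue (e.symm i) := rfl
  have hj : e.symm i ≠ ⟨0, by omega⟩ := fun h' => hi (by rw [← h', e.apply_symm_apply])
  rw [hval, spectralLambda, max_comm]
  have hanti := G.adjMatrix_real_isHermitian.eigenvalues₀_antitone
  refine abs_le_max_abs_abs (hanti ?_) (hanti ?_)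
  · rw [Fin.le_def]
    have := (e.symm i).2
    simp only
    omega
  · rw [Fin.le_def]
    have : (e.symm i).1 ≠ 0 := fun h' => hj (Fin.ext h')
    simp only
    omega

open scoped Matrix in
/-- The upper half of the expander mixing lemma, for a regular graph. -/
theorem mixing_of_spectralLambda_le (G : SimpleGraph V) [DecidableRel G.Adj] {d : ℕ}
    (hd : 0 < d) (hreg : ∀ v, G.valency v = d) (h : 2 ≤ Fintype.card V)
    (hlam : G.spectralLambda h ≤ (d : ℝ) / 12) : G.Mixing d := by
  obtain ⟨i₀, hi₀⟩ := G.exists_abs_eigenvalues_le h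
  set hA := G.adjMatrix_real_isHermitian
  set A := G.adjMatrix ℝ with hAdef
  set μ := hA.eigenvalues
  have hd0 : (0 : ℝ) < d := by exact_mod_cast hd
  let u : V → V → ℝ := fun i => ⇑(hA.eigenvectorBasis i)
  have hparseval : ∀ x y : V → ℝ, x ⬝ᵥ y = ∑ i, (u i ⬝ᵥ x) * (u i ⬝ᵥ y) := by
    intro x y
    have := hA.eigenvectorBasis.sum_inner_mul_inner (WithLp.toLp 2 x) (WithLp.toLp 2 y)
    simp only [EuclideanSpace.inner_eq_star_dotProduct, star_trivial] at this
    rw [dotProduct_comm x y, ← this]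
    refine sum_congr rfl fun i _ => ?_
    rw [dotProduct_comm (u i) y]
  have hAu : ∀ i x, u i ⬝ᵥ (A *ᵥ x) = μ i * (u i ⬝ᵥ x) := by
    intro i x
    have h1 : A *ᵥ u i = μ i • u i := hA.mulVec_eigenvectorBasis i
    rw [Matrix.dotProduct_mulVec, ← Matrix.mulVec_transpose, G.isSymm_adjMatrix.eq, h1,
      smul_dotProduct, smul_eq_mul]
  have hmul : ∀ (X : Finset V) (v : V),
      (A *ᵥ fun w => if w ∈ X then 1 else 0) v = #(G.nbhd v ∩ X) := by
    intro X v
    rw [hAdef, adjMatrix_mulVec_apply, sum_ite_mem, sum_const, nsmul_one]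
    congr 2
    ext w
    simp
  let c : Finset V → V → ℝ := fun X i => u i ⬝ᵥ fun w => if w ∈ X then 1 else 0
  have hdot : ∀ (X : Finset V) (f : V → ℝ),
      (fun w => if w ∈ X then (1 : ℝ) else 0) ⬝ᵥ f = ∑ v ∈ X, f v := by
    intro X f
    simp [dotProduct, sum_ite_mem]
  have hcnt : ∀ X Y : Finset V, (G.cnt X Y : ℝ) = ∑ i, μ i * (c X i * c Y i) := by
    intro X Y
    have h1 := hparseval (fun w => if w ∈ X then 1 else 0) (A *ᵥ fun w => if w ∈ Y then 1 else 0)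
    rw [hdot, sum_congr rfl fun v _ => hmul Y v] at h1
    have h2 : (G.cnt X Y : ℝ) = ∑ v ∈ X, (#(G.nbhd v ∩ Y) : ℝ) := by
      rw [cnt]
      push_cast
      congr!
    rw [h2, h1]
    refine sum_congr rfl fun i _ => ?_
    rw [hAu]
    ring
  have hinter : ∀ X Y : Finset V, (#(X ∩ Y) : ℝ) = ∑ i, c X i * c Y i := by
    intro X Y
    rw [← hparseval, hdot, sum_ite_mem]
    simp
  have hones : ∀ i, ((d : ℝ) - μ i) * c univ i = 0 := by
    intro i
    have h1 := hAu i fun w => if w ∈ univ then 1 else 0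
    have h2 : (A *ᵥ fun w => if w ∈ (univ : Finset V) then (1 : ℝ) else 0) =
        (d : ℝ) • fun w => if w ∈ (univ : Finset V) then (1 : ℝ) else 0 := by
      ext v
      rw [hmul]
      have := hreg v
      rw [valency] at this
      simp [this]
    rw [h2, dotProduct_smul, smul_eq_mul] at h1
    rw [sub_mul, sub_eq_zero]
    exact h1
  -- The all-ones vector is an eigenvector for d, and all eigenvalues but one are at most d/12 < d,
  -- so it is orthogonal to all basis vectors except `u i₀`. This also identifies the remaining
  -- eigenvalue as d.
  have hne : ∀ i, i ≠ i₀ → c univ i = 0 := by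
    intro i hi
    refine (mul_eq_zero.1 (hones i)).resolve_left fun h0 => ?_
    have h1 := (le_abs_self _).trans ((hi₀ i hi).trans hlam)
    linarith
  have hX : ∀ X : Finset V, (#X : ℝ) = c X i₀ * c univ i₀ := by
    intro X
    have := hinter X univ
    rw [inter_univ] at this
    rw [this]
    exact sum_eq_single i₀ (fun i _ hi => by rw [hne i hi, mul_zero]) (by simp)
  have hn : (Fintype.card V : ℝ) = c univ i₀ * c univ i₀ := by
    rw [← hX, card_univ]
  have hn0 : (0 : ℝ) < Fintype.card V := by
    exact_mod_cast (show 0 < Fintype.card V by omega)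
  have hc0 : c univ i₀ ≠ 0 := fun h0 => by
    rw [h0, mul_zero] at hn
    exact hn0.ne' hn
  have hμ : μ i₀ = d := by
    have := (mul_eq_zero.1 (hones i₀)).resolve_right hc0
    linarith
  intro X Y
  rw [hcnt, ← add_sum_erase _ _ (mem_univ i₀), hμ]
  refine add_le_add (le_of_eq ?_) ?_
  · rw [hX X, hX Y, hn]
    field_simp
  · have hsq : ∀ X : Finset V, ∑ i ∈ univ.erase i₀, c X i * c X i ≤ #X := by
      intro X
      have := hinter X X
      rw [inter_self] at this
      rw [this]
      exact sum_le_sum_of_subset_of_nonneg (erase_subset _ _) fun i _ _ => mul_self_nonneg _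
    calc ∑ i ∈ univ.erase i₀, μ i * (c X i * c Y i) ≤
        ∑ i ∈ univ.erase i₀, (d : ℝ) / 24 * (c X i * c X i + c Y i * c Y i) := by
          refine sum_le_sum fun i hi => ?_
          have h1 := abs_le.1 ((hi₀ i (ne_of_mem_erase hi)).trans hlam)
          -- From (d/12 - μ)(a + b)² + (d/12 + μ)(a - b)² ≥ 0 one gets μab ≤ (d/24)(a² + b²).
          nlinarith [mul_nonneg (sub_nonneg.2 h1.2) (sq_nonneg (c X i + c Y i)),
            mul_nonneg (neg_le_iff_add_nonneg.1 h1.1) (sq_nonneg (c X i - c Y i))]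
      _ = (d : ℝ) / 24 * (∑ i ∈ univ.erase i₀, c X i * c X i +
          ∑ i ∈ univ.erase i₀, c Y i * c Y i) := by
          rw [← mul_sum, sum_add_distrib]
      _ ≤ _ := mul_le_mul_of_nonneg_left (add_le_add (hsq X) (hsq Y)) (by positivity)

end SimpleGraph

end Spectral

/-! ### From disjoint 1-regular graphs to perfect matchings as subgraphs. -/

section OneFactorization

namespace SimpleGraph

/-- A graph all of whose edges lie in `G`, as a spanning subgraph of `G`. -/
def meetSubgraph {V : Type*} (G M : SimpleGraph V) : G.Subgraph where
  verts := Set.univ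
  Adj u v := M.Adj u v ∧ G.Adj u v
  adj_sub h := h.2
  edge_vert _ := trivial
  symm := ⟨fun _ _ h => ⟨h.1.symm, h.2.symm⟩⟩

theorem Factorable.exists_isOneFactorization {V : Type*} {G : SimpleGraph V}
    (hG : G.Factorable) : ∃ F : Set G.Subgraph, G.IsOneFactorization F := by
  obtain ⟨S, hS1, hS2, hS3⟩ := hG
  have hle : ∀ M ∈ S, M ≤ G := fun M hM => hS3 ▸ le_sSup hM
  have hmem : ∀ M ∈ S, ∀ e, e ∈ (G.meetSubgraph M).edgeSet ↔ e ∈ M.edgeSet := by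
    intro M hM e
    induction e with
    | _ u v => exact ⟨fun h => h.1, fun h => ⟨h, hle M hM h⟩⟩
  refine ⟨G.meetSubgraph '' S, ?_, ?_, ?_⟩
  · rintro _ ⟨M, hM, rfl⟩
    rw [Subgraph.isPerfectMatching_iff]
    intro v
    obtain ⟨w, hw, huniq⟩ := hS1 M hM v
    exact ⟨w, ⟨hw, hle M hM hw⟩, fun x hx => huniq x hx.1⟩
  · rintro _ ⟨M, hM, rfl⟩ _ ⟨N, hN, rfl⟩ hne
    have hdis := hS2 hM hN fun h => hne (by rw [h])
    rw [Set.disjoint_left]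
    intro e he he'
    rw [hmem M hM] at he
    rw [hmem N hN] at he'
    induction e with
    | _ u v => exact disjoint_left.1 hdis u v he he'
  · ext e
    simp only [Set.mem_iUnion, Set.mem_image, exists_prop]
    constructor
    · rintro ⟨_, ⟨M, hM, rfl⟩, he⟩
      exact edgeSet_mono (hle M hM) ((hmem M hM e).1 he)
    · intro he
      rw [← hS3] at he
      induction e with
      | _ u v =>
        obtain ⟨M, hM, h⟩ := sSup_adj.1 he
        exact ⟨_, ⟨M, hM, rfl⟩, (hmem M hM _).2 h⟩

theorem valency_eq_degree {V : Type*} [Fintype V] (G : SimpleGraph V) [DecidableRel G.Adj] (v : V) :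
    G.valency v = G.degree v := by
  rw [valency, degree]
  congr 1
  ext w
  simp

end SimpleGraph

end OneFactorization

theorem corollary1p4 :
    ∃ d₀ : ℕ, ∀ d : ℕ, d₀ ≤ d → ∀ n : ℕ, Even n → d + 1 ≤ n →
      ∀ (lam : ℝ), lam ≤ (d : ℝ) / 12 →
        ∀ (G : SimpleGraph (Fin n)) [DecidableRel G.Adj], G.IsNDLambdaGraph n d lam →
          ∃ F : Set G.Subgraph, G.IsOneFactorization F := by
  obtain ⟨d₀, hd₀⟩ := SimpleGraph.exists_factorable_of_mixing
  -- d ≥ 1 gives n ≥ 2, so that `λ₂` exists, and d/12 < d, which the mixing lemma needs.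
  refine ⟨max d₀ 1, fun d hd n hn hdn lam hlam G _ hG => ?_⟩
  obtain ⟨-, hreg, hspec⟩ := hG
  have hd1 : 1 ≤ d := (le_max_right _ _).trans hd
  have hcard : 2 ≤ Fintype.card (Fin n) := by
    rw [Fintype.card_fin]
    omega
  have hval : ∀ v, G.valency v = d := fun v => (G.valency_eq_degree v).trans (hreg v)
  exact (hd₀ d ((le_max_left _ _).trans hd) (by rwa [Fintype.card_fin]) hval
    (G.mixing_of_spectralLambda_le hd1 hval hcard
      ((hspec hcard).trans hlam))).exists_isOneFactorization
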